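/- Let $G=(V,E)$ be a finite skew-symmetric graph: a finite digraph (parallel arcs allowed) with a map $\sigma$ of $V$ to $V$ and of $E$ to $E$ such that $\sigma(x)\ne x=\sigma(\sigma(x))$ for every $x\in V\cup E$ and such that $\sigma$ maps each arc from $v$ to $w$ to an arc from $\sigma(w)$ to $\sigma(v)$. Let $u:E\to\mathbb Z_{\ge 0}$ be a capacity function with $u(\sigma(a))=u(a)$ for all $a\in E$, let $s\in V$ be a source, let $s'=\sigma(s)$ be the sink, and assume that no arc enters $s$. A flow is a function $f:E\to\mathbb R$ with $0\le f(a)\le u(a)$ for all $a\in E$ (capacity constraints) and with the total of $f$ on the arcs leaving $v$ equal to the total on the arcs entering $v$ for all $v\in V\setminus\{s,s'\}$ (conservation constraints). Its value $|f|$ is the total of $f$ on the arcs leaving $s$. An IS-flow is a flow that is integer-valued and symmetric, i.e. $f(a)=f(\sigma(a))$ for all $a\in E$; it is maximum if its value is largest among all IS-flows. An odd fragment is a pair $\rho=(V_\rho,U_\rho)$ where $V_\rho\subseteq V$ satisfies $\sigma(V_\rho)=V_\rho$ and $s\notin V_\rho$, and $U_\rho$ is a set of arcs entering $V_\rho$ (from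 $V\setminus V_\rho$) whose total capacity $u(U_\rho)=\sum_{a\in U_\rho}u(a)$ is odd. Let $\chi_\rho(a)=1$ if $a\in U_\rho\cup\sigma(U_\rho)$, let $\chi_\rho(a)=-1$ if $a\notin U_\rho\cup\sigma(U_\rho)$ and exactly one end of $a$ lies in $V_\rho$, and let $\chi_\rho(a)=0$ otherwise. Theorem. Every maximum IS-flow is an optimal solution of the linear program that maximizes $|f|$ over all real-valued flows $f$ satisfying $$\sum_{a\in E} f(a)\chi_\rho(a)\le 2u(U_\rho)-2\qquad\text{for every odd fragment }\rho .$$ Consequently, the following three problems attain their maxima and have the same optimum value: maximizing $|f|$ over IS-flows; maximizing $|f|$ over IS-flows that satisfy the odd-fragment constraints; and the linear program above. That is, the symmetry and integrality constraints may be dropped without changing the optimum value. -/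

import Mathlib

/-- A skew-symmetric graph: a digraph with node set `V` and arc set `E` (parallel arcs and loops
are allowed) together with a fixed-point-free involution of the nodes and of the arcs that
maps an arc from `v` to `w` to an arc from the mate of `w` to the mate of `v`. -/
structure SkewSymmetricGraph (V E : Type*) where
  src : E → V
  tgt : E → V
  nodeMate : V → V
  arcMate : E → E
  nodeMate_ne : ∀ v, nodeMate v ≠ v
  arcMate_ne : ∀ a, arcMate a ≠ a
  nodeMate_nodeMate : ∀ v, nodeMate (nodeMate v) = v
  arcMate_arcMate : ∀ a, arcMate (arcMate a) = a
  src_arcMate : ∀ a, src (arcMate a) = nodeMate (tgt a)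
  tgt_arcMate : ∀ a, tgt (arcMate a) = nodeMate (src a)

/-- A skew-symmetric network: a skew-symmetric graph with symmetric nonnegative integer arc
capacities and a source. -/
structure SkewSymmetricNetwork (V E : Type*) extends SkewSymmetricGraph V E where
  cap : E → ℕ
  cap_arcMate : ∀ a, cap (arcMate a) = cap a
  source : V

namespace SkewSymmetricNetwork

variable {V E : Type*}

/-- The sink is the mate of the source. -/
def sink (N : SkewSymmetricNetwork V E) : V := N.nodeMate N.source

open Classical in
/-- Total flow on the arcs leaving `x` minus total flow on the arcs entering `x`. -/
noncomputable def divergence [Fintype E] (N : SkewSymmetricNetwork V E) (f : E → ℝ) (x : V) : ℝ :=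
  (∑ a with N.src a = x, f a) - ∑ a with N.tgt a = x, f a

/-- The value of a flow. -/
noncomputable def value [Fintype E] (N : SkewSymmetricNetwork V E) (f : E → ℝ) : ℝ :=
  N.divergence f N.source

open Classical in
/-- The objective function of the programs: the total flow on the arcs leaving the source. -/
noncomputable def outflow [Fintype E] (N : SkewSymmetricNetwork V E) (f : E → ℝ) : ℝ :=
  ∑ a with N.src a = N.source, f a

/-- A (real-valued, not necessarily symmetric) flow: nonnegativity, capacity constraints and
conservation constraints. -/
structure IsFlow [Fintype E] (N : SkewSymmetricNetwork V E) (f : E → ℝ) : Prop where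
  nonneg : ∀ a, 0 ≤ f a
  le_cap : ∀ a, f a ≤ (N.cap a : ℝ)
  conservation : ∀ x, x ≠ N.source → x ≠ N.sink → N.divergence f x = 0

/-- An IS-flow: an integer symmetric flow. -/
structure IsISFlow [Fintype E] (N : SkewSymmetricNetwork V E) (f : E → ℝ) : Prop
    extends N.IsFlow f where
  symmetric : ∀ a, f a = f (N.arcMate a)
  integral : ∀ a, ∃ k : ℤ, f a = (k : ℝ)

/-- An IS-flow of maximum value among all IS-flows. -/
def IsMaximumISFlow [Fintype E] (N : SkewSymmetricNetwork V E) (f : E → ℝ) : Prop :=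
  N.IsISFlow f ∧ ∀ g : E → ℝ, N.IsISFlow g → N.value g ≤ N.value f

/-- An odd fragment: a self-symmetric set of nodes avoiding the source, and a set of arcs
entering it with odd total capacity. -/
structure OddFragment (N : SkewSymmetricNetwork V E) where
  nodes : Set V
  arcs : Finset E
  nodes_symm : N.nodeMate '' nodes = nodes
  source_notMem : N.source ∉ nodes
  arcs_enter : ∀ a ∈ arcs, N.src a ∉ nodes ∧ N.tgt a ∈ nodes
  odd_cap : Odd (∑ a ∈ arcs, N.cap a)

open Classical in
/-- The characteristic function of an odd fragment: `1` on the chosen arcs and their mates, `-1`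
on the other arcs with exactly one end in the node set, and `0` elsewhere. -/
noncomputable def OddFragment.chi {N : SkewSymmetricNetwork V E} (ρ : N.OddFragment) (a : E) : ℝ :=
  if a ∈ ρ.arcs ∨ ∃ b ∈ ρ.arcs, N.arcMate b = a then 1
  else if ¬(N.src a ∈ ρ.nodes ↔ N.tgt a ∈ ρ.nodes) then -1
  else 0

/-- The odd fragment constraints. -/
def SatisfiesOddFragmentConstraints [Fintype E] (N : SkewSymmetricNetwork V E) (f : E → ℝ) :
    Prop :=
  ∀ ρ : N.OddFragment, ∑ a, f a * ρ.chi a ≤ 2 * (∑ a ∈ ρ.arcs, (N.cap a : ℝ)) - 2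

/-- The feasible region of the linear program with nonnegativity, capacity, conservation and odd
fragment constraints. -/
def lpFeasible [Fintype E] (N : SkewSymmetricNetwork V E) : Set (E → ℝ) :=
  {f | N.IsFlow f ∧ N.SatisfiesOddFragmentConstraints f}

end SkewSymmetricNetwork

/-! Optimality is certified by an obstruction to augmentation. Split every arc into unit arcs and
reverse those carrying flow of an integer symmetric flow `n`; this residual graph is again
skew-symmetric. A regular walk from source to sink is arc-disjoint from its mate, so augmenting
along both preserves symmetry and raises the value by 2 (`exists_flow_of_regularWalk`). At a maximum
IS-flow there is no such walk, and `exists_regularWalk_or_barrier` yields a barrier: a set A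
(`inner`) containing the source and disjoint from its mate, and disjoint self-symmetric fragments,
each entered from A by exactly one residual unit arc.

The barrier acts as a dual solution. Let U be the arcs from A to a fragment and L those from the
fragment to A. Uniqueness of the residual arc says u(U) + n(L) = n(U) + 1. An IS-flow sends an even
amount into a self-symmetric set without terminals (`even_sum_entering`), so u(U) is odd, and the
constraint of this odd fragment is tight at `n`. All other arcs leaving A are saturated and all
other arcs entering A are empty. The cut function of A plus its mate is the sum of the fragments' χ
and of terms obeying complementary slackness, so no LP solution beats `n` (`value_le_of_barrier`).
Feasibility of IS-flows is the same parity argument.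

The barrier comes from induction on the number of arcs: A grows along an arc `a` leaving it, or, if
the head of `a` reaches its own mate, the nodes met and their mates are contracted like a blossom
entered through `a`. -/

namespace SkewSymmetricGraph

/-! ### Walks and regular walks. -/

variable {V E : Type*}

/-- `G.IsWalk v l w`: the list of arcs `l` is a directed walk from `v` to `w`. -/
def IsWalk (G : SkewSymmetricGraph V E) : V → List E → V → Prop
  | v, [], w => v = w
  | v, a :: l, w => G.src a = v ∧ G.IsWalk (G.tgt a) l w

theorem isWalk_append (G : SkewSymmetricGraph V E) {v w : V} {l m : List E} :
    G.IsWalk v (l ++ m) w ↔ ∃ x, G.IsWalk v l x ∧ G.IsWalk x m w := by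
  induction l generalizing v with
  | nil => simp [IsWalk]
  | cons a l ih => simp [IsWalk, ih, and_assoc]

theorem IsWalk.mate {G : SkewSymmetricGraph V E} {v w : V} {l : List E} (h : G.IsWalk v l w) :
    G.IsWalk (G.nodeMate w) (l.map G.arcMate).reverse (G.nodeMate v) := by
  induction l generalizing v with
  | nil => exact congrArg G.nodeMate (show v = w from h).symm
  | cons a l ih =>
    obtain ⟨rfl, h⟩ := h
    simp only [List.map_cons, List.reverse_cons, isWalk_append]
    exact ⟨_, ih h, by simp [IsWalk, G.src_arcMate, G.tgt_arcMate]⟩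

/-- A regular walk: no arc is repeated or used together with its mate. -/
structure IsRegularWalk (G : SkewSymmetricGraph V E) (S : Finset E) (v : V) (l : List E) (w : V) :
    Prop where
  walk : G.IsWalk v l w
  mem : ∀ a ∈ l, a ∈ S
  pairwise : l.Pairwise fun a b => a ≠ b ∧ G.arcMate a ≠ b

theorem arcMate_eq_comm (G : SkewSymmetricGraph V E) {a b : E} :
    G.arcMate a = b ↔ a = G.arcMate b :=
  ⟨fun h => by rw [← h, G.arcMate_arcMate], fun h => by rw [h, G.arcMate_arcMate]⟩

theorem nodeMate_eq_comm (G : SkewSymmetricGraph V E) {a b : V} :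
    G.nodeMate a = b ↔ a = G.nodeMate b :=
  ⟨fun h => by rw [← h, G.nodeMate_nodeMate], fun h => by rw [h, G.nodeMate_nodeMate]⟩

theorem arcMate_injective (G : SkewSymmetricGraph V E) : Function.Injective G.arcMate :=
  Function.LeftInverse.injective G.arcMate_arcMate

theorem IsRegularWalk.mate {G : SkewSymmetricGraph V E} {S : Finset E}
    (hS : ∀ a ∈ S, G.arcMate a ∈ S) {v w : V} {l : List E} (h : G.IsRegularWalk S v l w) :
    G.IsRegularWalk S (G.nodeMate w) (l.map G.arcMate).reverse (G.nodeMate v) where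
  walk := h.walk.mate
  mem := by
    simp only [List.mem_reverse, List.mem_map]
    rintro _ ⟨a, ha, rfl⟩
    exact hS a (h.mem a ha)
  pairwise := by
    rw [List.pairwise_reverse, List.pairwise_map]
    refine h.pairwise.imp fun {a b} hab => ⟨fun e => hab.1 (G.arcMate_injective e).symm, fun e => ?_⟩
    rw [G.arcMate_arcMate] at e
    exact hab.2 e.symm

theorem IsRegularWalk.mono {G : SkewSymmetricGraph V E} {S S' : Finset E} (hS : S ⊆ S')
    {v w : V} {l : List E} (h : G.IsRegularWalk S v l w) : G.IsRegularWalk S' v l w :=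
  ⟨h.walk, fun a ha => hS (h.mem a ha), h.pairwise⟩

theorem IsRegularWalk.append {G : SkewSymmetricGraph V E} {S : Finset E} {v x w : V}
    {l m : List E} (hl : G.IsRegularWalk S v l x) (hm : G.IsRegularWalk S x m w)
    (hlm : ∀ a ∈ l, ∀ b ∈ m, a ≠ b ∧ G.arcMate a ≠ b) : G.IsRegularWalk S v (l ++ m) w where
  walk := (G.isWalk_append).2 ⟨x, hl.walk, hm.walk⟩
  mem := fun a ha => (List.mem_append.1 ha).elim (hl.mem a) (hm.mem a)
  pairwise := List.pairwise_append.2 ⟨hl.pairwise, hm.pairwise, hlm⟩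

theorem IsRegularWalk.of_append {G : SkewSymmetricGraph V E} {S : Finset E} {v w : V}
    {l m : List E} (h : G.IsRegularWalk S v (l ++ m) w) {x : V} (hl : G.IsWalk v l x)
    (hm : G.IsWalk x m w) : G.IsRegularWalk S v l x ∧ G.IsRegularWalk S x m w :=
  ⟨⟨hl, fun a ha => h.mem a (List.mem_append_left _ ha), (List.pairwise_append.1 h.pairwise).1⟩,
    ⟨hm, fun a ha => h.mem a (List.mem_append_right _ ha),
      (List.pairwise_append.1 h.pairwise).2.1⟩⟩

theorem IsRegularWalk.single {G : SkewSymmetricGraph V E} {S : Finset E} {a : E} (ha : a ∈ S) :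
    G.IsRegularWalk S (G.src a) [a] (G.tgt a) :=
  ⟨by simp [IsWalk], by simpa using ha, by simp⟩

/-! ### Barriers and contraction of self-symmetric node sets. -/

/-- A barrier for the arc set `S`: node sets `inner` (disjoint from its mate) and `fragments`
(self-symmetric), where `base` assigns to each node of `fragments` the only arc that enters its
fragment from `inner`. -/
structure Barrier (G : SkewSymmetricGraph V E) (S : Finset E) where
  inner : Set V
  fragments : Set V
  base : V → E
  mate_notMem_inner : ∀ v ∈ inner, G.nodeMate v ∉ inner
  notMem_fragments : ∀ v ∈ inner, v ∉ fragments
  mate_mem_fragments : ∀ v ∈ fragments, G.nodeMate v ∈ fragments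
  base_mate : ∀ v ∈ fragments, base (G.nodeMate v) = base v
  leave_inner : ∀ b ∈ S, G.src b ∈ inner →
    G.tgt b ∈ inner ∨ (G.tgt b ∈ fragments ∧ base (G.tgt b) = b)
  leave_fragment : ∀ b ∈ S, G.src b ∈ fragments → G.tgt b ∈ inner ∨
    G.nodeMate (G.tgt b) ∈ inner ∨ (G.tgt b ∈ fragments ∧ base (G.tgt b) = base (G.src b))
  base_mem : ∀ v ∈ fragments, base v ∈ S
  src_base : ∀ v ∈ fragments, G.src (base v) ∈ inner
  tgt_base : ∀ v ∈ fragments, G.tgt (base v) ∈ fragments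

open Classical in
/-- Contraction of a self-symmetric node set `T` to the head `w` of an arc `a` entering it and to
the mate of `w`: apart from `a` and its mate, arcs leave `T` from `w` and enter `T` at its mate. -/
noncomputable def trim (G : SkewSymmetricGraph V E) (T : Set V) (a : E)
    (hT : ∀ v ∈ T, G.nodeMate v ∈ T) : SkewSymmetricGraph V E :=
  { G with
    src := fun b => if b = G.arcMate a then G.nodeMate (G.tgt a) else
      if G.src b ∈ T then G.tgt a else G.src b
    tgt := fun b => if b = a then G.tgt a else
      if G.tgt b ∈ T then G.nodeMate (G.tgt a) else G.tgt b
    src_arcMate := by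
      intro b
      have h : G.nodeMate (G.tgt b) ∈ T ↔ G.tgt b ∈ T :=
        ⟨fun h => by simpa [G.nodeMate_nodeMate] using hT _ h, hT _⟩
      simp only [G.arcMate_injective.eq_iff, G.src_arcMate, h]
      split_ifs <;> simp [G.nodeMate_nodeMate]
    tgt_arcMate := by
      intro b
      have h : G.nodeMate (G.src b) ∈ T ↔ G.src b ∈ T :=
        ⟨fun h => by simpa [G.nodeMate_nodeMate] using hT _ h, hT _⟩
      simp only [G.arcMate_eq_comm, G.tgt_arcMate, h]
      split_ifs <;> simp [G.nodeMate_nodeMate] }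

section Trim

variable {G : SkewSymmetricGraph V E} {T : Set V} {a : E} {hT : ∀ v ∈ T, G.nodeMate v ∈ T}

theorem trim_src_of_notMem (hw : G.tgt a ∈ T) {b : E} (hb : G.src b ∉ T) :
    (G.trim T a hT).src b = G.src b := by
  have : b ≠ G.arcMate a := by
    rintro rfl
    exact hb (by rw [G.src_arcMate]; exact hT _ hw)
  simp [trim, this, hb]

theorem trim_src_of_mem {b : E} (hb : G.src b ∈ T) (hba : b ≠ G.arcMate a) :
    (G.trim T a hT).src b = G.tgt a := by
  simp [trim, hb, hba]

theorem trim_src_mate : (G.trim T a hT).src (G.arcMate a) = G.nodeMate (G.tgt a) := by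
  simp [trim]

theorem trim_tgt_of_notMem (hw : G.tgt a ∈ T) {b : E} (hb : G.tgt b ∉ T) :
    (G.trim T a hT).tgt b = G.tgt b := by
  have : b ≠ a := by
    rintro rfl
    exact hb hw
  simp [trim, this, hb]

theorem trim_tgt_of_mem {b : E} (hb : G.tgt b ∈ T) (hba : b ≠ a) :
    (G.trim T a hT).tgt b = G.nodeMate (G.tgt a) := by
  simp [trim, hb, hba]

theorem trim_tgt_self : (G.trim T a hT).tgt a = G.tgt a := by
  simp [trim]

theorem trim_arcMate : (G.trim T a hT).arcMate = G.arcMate := rfl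

theorem mem_of_mate_mem (hT : ∀ v ∈ T, G.nodeMate v ∈ T) {v : V} (h : G.nodeMate v ∈ T) : v ∈ T := by
  simpa [G.nodeMate_nodeMate] using hT _ h

open Classical in
/-- The arcs of `S` that survive when `T` is contracted. -/
noncomputable def outerArcs (G : SkewSymmetricGraph V E) (T : Set V) (S : Finset E) : Finset E :=
  S.filter fun b => ¬(G.src b ∈ T ∧ G.tgt b ∈ T)

open Classical in
/-- The arcs of `S` inside `T`. -/
noncomputable def innerArcs (G : SkewSymmetricGraph V E) (T : Set V) (S : Finset E) : Finset E :=
  S.filter fun b => G.src b ∈ T ∧ G.tgt b ∈ T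

theorem mem_outerArcs {S : Finset E} {b : E} :
    b ∈ G.outerArcs T S ↔ b ∈ S ∧ ¬(G.src b ∈ T ∧ G.tgt b ∈ T) := by
  simp [outerArcs]

theorem mem_innerArcs {S : Finset E} {b : E} :
    b ∈ G.innerArcs T S ↔ b ∈ S ∧ (G.src b ∈ T ∧ G.tgt b ∈ T) := by
  simp [innerArcs]

theorem mate_mem_outerArcs (hT : ∀ v ∈ T, G.nodeMate v ∈ T) {S : Finset E}
    (hS : ∀ b ∈ S, G.arcMate b ∈ S) {b : E} (hb : b ∈ G.outerArcs T S) :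
    G.arcMate b ∈ G.outerArcs T S := by
  rw [mem_outerArcs] at hb ⊢
  refine ⟨hS b hb.1, fun h => hb.2 ?_⟩
  rw [G.src_arcMate, G.tgt_arcMate] at h
  exact ⟨mem_of_mate_mem hT h.2, mem_of_mate_mem hT h.1⟩

theorem inner_ne_outer (hT : ∀ v ∈ T, G.nodeMate v ∈ T) {S : Finset E} {b c : E}
    (hb : b ∈ G.innerArcs T S) (hc : c ∈ G.outerArcs T S) : b ≠ c ∧ G.arcMate b ≠ c := by
  rw [mem_innerArcs] at hb
  rw [mem_outerArcs] at hc
  refine ⟨fun h => hc.2 (h ▸ hb.2), fun h => hc.2 ?_⟩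
  rw [← h, G.src_arcMate, G.tgt_arcMate]
  exact ⟨hT _ hb.2.2, hT _ hb.2.1⟩

/-- A walk that enters `T` other than by `a` arrives at the mate of the head of `a`, from where only
the mate of `a` departs. Avoiding both arcs therefore means avoiding `T`, where the contraction
changes nothing. -/
theorem isWalk_of_trim (hw : G.tgt a ∈ T) {x y : V} (hx : x ∉ T) (hy : y ∉ T) {l : List E}
    (hl : (G.trim T a hT).IsWalk x l y) (ha : a ∉ l) (ha' : G.arcMate a ∉ l) :
    G.IsWalk x l y := by
  induction l generalizing x with
  | nil => exact hl
  | cons b l ih =>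
    simp only [List.mem_cons, not_or] at ha ha'
    obtain ⟨hb, hl⟩ := hl
    have h1 : G.src b ∉ T := by
      intro h
      rw [trim_src_of_mem h (Ne.symm ha'.1)] at hb
      exact hx (hb ▸ hw)
    rw [trim_src_of_notMem hw h1] at hb
    have h2 : G.tgt b ∉ T := by
      intro h
      rw [trim_tgt_of_mem h (Ne.symm ha.1)] at hl
      cases l with
      | nil => exact hy (by rw [← show _ = y from hl]; exact hT _ hw)
      | cons c l =>
        obtain ⟨hc, -⟩ := hl
        by_cases h3 : G.src c ∈ T
        · rw [trim_src_of_mem h3 (fun h => ha'.2 (by simp [h]))] at hc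
          exact G.nodeMate_ne _ hc.symm
        · rw [trim_src_of_notMem hw h3] at hc
          exact h3 (hc ▸ hT _ hw)
    rw [trim_tgt_of_notMem hw h2] at hl
    exact ⟨hb, ih h2 hl ha.2 ha'.2⟩

/-- The walk goes on from the head of `a` by an arc whose true tail is some other node of `T`; a
regular walk inside `T` fills the gap. Regularity survives because arcs inside `T` and their mates
are absent from the contracted graph. -/
theorem exists_regularWalk_of_trim_of_mem {S : Finset E} (haT : G.src a ∉ T)
    (hw : G.tgt a ∈ T)
    (hin : ∀ x ∈ T, ∃ l, G.IsRegularWalk (G.innerArcs T S) (G.tgt a) l x) {x y : V} (hx : x ∉ T)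
    (hy : y ∉ T) {l : List E} (hl : (G.trim T a hT).IsRegularWalk (G.outerArcs T S) x l y)
    (ha : a ∈ l) : ∃ m, G.IsRegularWalk S x m y := by
  obtain ⟨l₁, l₂, rfl⟩ := List.append_of_mem ha
  obtain ⟨p, hw₁, hp, hw₂⟩ := (isWalk_append _).1 hl.walk
  rw [trim_src_of_notMem hw haT] at hp
  rw [trim_tgt_self] at hw₂
  have hpw := List.pairwise_append.1 hl.pairwise
  have hpw₂ := List.pairwise_cons.1 hpw.2.1
  rw [trim_arcMate] at hpw hpw₂
  have hlS : ∀ b ∈ l₁, b ∈ G.outerArcs T S := fun b hb => hl.mem b (by simp [hb])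
  have hlS₂ : ∀ b ∈ l₂, b ∈ G.outerArcs T S := fun b hb => hl.mem b (by simp [hb])
  have haS : a ∈ G.outerArcs T S := hl.mem a (by simp)
  have hsub : G.outerArcs T S ⊆ S := fun b hb => (mem_outerArcs.1 hb).1
  have hsub' : G.innerArcs T S ⊆ S := fun b hb => (mem_innerArcs.1 hb).1
  have R₁ : G.IsRegularWalk S x l₁ p := by
    refine ⟨isWalk_of_trim hw hx (hp ▸ haT) hw₁ (fun h => ?_) (fun h => ?_),
      fun b hb => hsub (hlS b hb), hpw.1⟩
    · exact (hpw.2.2 _ h a (by simp)).1 rfl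
    · exact (hpw.2.2 _ h a (by simp)).2 (G.arcMate_arcMate a)
  cases l₂ with
  | nil => exact absurd (show G.tgt a = y from hw₂) (fun h => hy (h ▸ hw))
  | cons b l₃ =>
    obtain ⟨hb, hw₃⟩ := hw₂
    -- Regularity excludes the mate of `a`, the only arc leaving the contracted set at its other
    -- node.
    have hba : b ≠ G.arcMate a := fun h => (hpw₂.1 b (by simp)).2 h.symm
    have hb1 : G.src b ∈ T := by
      by_contra h
      rw [trim_src_of_notMem hw h] at hb
      exact h (hb ▸ hw)
    have hb2 : G.tgt b ∉ T := fun h => (mem_outerArcs.1 (hlS₂ b (by simp))).2 ⟨hb1, h⟩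
    rw [trim_tgt_of_notMem hw hb2] at hw₃
    have R₃ : G.IsRegularWalk S (G.src b) (b :: l₃) y := by
      refine ⟨⟨rfl, isWalk_of_trim hw hb2 hy hw₃ (fun h => ?_) (fun h => ?_)⟩,
        fun c hc => hsub (hlS₂ c hc), hpw₂.2⟩
      · exact (hpw₂.1 a (by simp [h])).1 rfl
      · exact (hpw₂.1 (G.arcMate a) (by simp [h])).2 rfl
    obtain ⟨m, hm⟩ := hin _ hb1
    have hcomm : ∀ c ∈ G.innerArcs T S, ∀ d ∈ G.outerArcs T S, d ≠ c ∧ G.arcMate d ≠ c := by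
      intro c hc d hd
      have := inner_ne_outer hT hc hd
      exact ⟨this.1.symm, fun h => this.2 (G.arcMate_eq_comm.1 h ▸ rfl)⟩
    have R₂ := (hm.mono hsub').append R₃
      (fun c hc d hd => inner_ne_outer hT (hm.mem c hc) (hlS₂ d hd))
    have R₄ : G.IsRegularWalk S p (a :: (m ++ b :: l₃)) y := by
      rw [← hp]
      refine (IsRegularWalk.single (hsub haS)).append R₂ ?_
      intro c hc d hd
      rw [List.mem_singleton.1 hc]
      rcases List.mem_append.1 hd with hd | hd
      · exact hcomm d (hm.mem d hd) a haS
      · exact hpw₂.1 d hd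
    refine ⟨_, R₁.append R₄ ?_⟩
    intro c hc d hd
    rcases List.mem_cons.1 hd with rfl | hd
    · exact hpw.2.2 c hc d (by simp)
    rcases List.mem_append.1 hd with hd | hd
    · exact hcomm d (hm.mem d hd) c (hlS c hc)
    · exact hpw.2.2 c hc d (by simp only [List.mem_cons] at hd ⊢; tauto)

/-- If the walk uses the mate of `a`, its mate walk uses `a`, which is the previous case. -/
theorem exists_regularWalk_of_trim {S : Finset E} (hS : ∀ b ∈ S, G.arcMate b ∈ S)
    (haT : G.src a ∉ T) (hw : G.tgt a ∈ T)
    (hin : ∀ x ∈ T, ∃ l, G.IsRegularWalk (G.innerArcs T S) (G.tgt a) l x) {x y : V} (hx : x ∉ T)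
    (hy : y ∉ T) {l : List E} (hl : (G.trim T a hT).IsRegularWalk (G.outerArcs T S) x l y) :
    ∃ m, G.IsRegularWalk S x m y := by
  by_cases h1 : a ∈ l
  · exact exists_regularWalk_of_trim_of_mem haT hw hin hx hy hl h1
  by_cases h2 : G.arcMate a ∈ l
  · have hm := hl.mate (G := G.trim T a hT) (fun b hb => mate_mem_outerArcs hT hS hb)
    obtain ⟨m, hm⟩ := exists_regularWalk_of_trim_of_mem haT hw hin
      (fun h => hy (mem_of_mate_mem hT h)) (fun h => hx (mem_of_mate_mem hT h)) hm
      (by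
        simp only [List.mem_reverse, List.mem_map]
        exact ⟨_, h2, G.arcMate_arcMate a⟩)
    have := hm.mate hS
    rw [G.nodeMate_nodeMate, G.nodeMate_nodeMate] at this
    exact ⟨_, this⟩
  · exact ⟨l, isWalk_of_trim hw hx hy hl.walk h1 h2, fun b hb => (mem_outerArcs.1 (hl.mem b hb)).1,
      hl.pairwise⟩

-- The head `w` of `a` is either inner, or in a fragment with base `a`. In the first case `T` and
-- all fragments whose base leaves `w` merge into one fragment with base `a`; in the second `T`
-- joins the fragment of `w`.
open Classical in
theorem exists_barrier_of_trim {S : Finset E} (hS : ∀ b ∈ S, G.arcMate b ∈ S) (haS : a ∈ S)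
    (haT : G.src a ∉ T) (hw : G.tgt a ∈ T) (B : (G.trim T a hT).Barrier (G.outerArcs T S))
    (haB : G.src a ∈ B.inner) : ∃ B' : G.Barrier S, B'.inner = B.inner \ T := by
  have mem_outer : ∀ b ∈ S, ¬(G.src b ∈ T ∧ G.tgt b ∈ T) → b ∈ G.outerArcs T S :=
    fun b hb h => mem_outerArcs.2 ⟨hb, h⟩
  have hw' : G.nodeMate (G.tgt a) ∈ T := hT _ hw
  have haO : a ∈ G.outerArcs T S := mem_outer a haS fun h => haT h.1
  have hmate : ∀ v ∈ B.fragments, G.nodeMate v ∈ B.fragments := B.mate_mem_fragments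
  have hmate' : ∀ v, G.nodeMate v ∈ B.fragments → v ∈ B.fragments := fun v h => by
    simpa [G.nodeMate_nodeMate] using hmate _ h
  have hbase : ∀ v ∈ B.fragments, B.base (G.nodeMate v) = B.base v := B.base_mate
  have hinner : ∀ v ∈ B.inner, G.nodeMate v ∉ B.inner := B.mate_notMem_inner
  have hwB : G.tgt a ∈ B.inner ∨ (G.tgt a ∈ B.fragments ∧ B.base (G.tgt a) = a) := by
    have := B.leave_inner a haO (by rwa [trim_src_of_notMem hw haT])
    rwa [trim_tgt_self] at this
  have hw'B : G.nodeMate (G.tgt a) ∉ B.inner := by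
    rcases hwB with h | h
    · exact hinner _ h
    · exact fun h' => B.notMem_fragments _ h' (hmate _ h.1)
  have hw_frag : G.nodeMate (G.tgt a) ∈ B.fragments → B.base (G.nodeMate (G.tgt a)) = a := by
    intro h
    have h2 := hmate' _ h
    rw [hbase _ h2]
    rcases hwB with h' | h'
    · exact absurd h2 (B.notMem_fragments _ h')
    · exact h'.2
  have hsrc_w : ∀ b, (G.trim T a hT).src b ∈ B.inner → (G.trim T a hT).src b ≠ G.tgt a →
      G.src b ∉ T := by
    intro b h1 h2 h3
    by_cases hba : b = G.arcMate a
    · rw [hba, trim_src_mate] at h1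
      exact hw'B h1
    · exact h2 (trim_src_of_mem h3 hba)
  set base' : V → E := fun v =>
    if v ∈ T ∨ (G.trim T a hT).src (B.base v) = G.tgt a then a else B.base v with hbase'
  have base'_T : ∀ v ∈ T, base' v = a := fun v hv => by simp [hbase', hv]
  have base'_w : ∀ v, (G.trim T a hT).src (B.base v) = G.tgt a → base' v = a :=
    fun v hv => by simp [hbase', hv]
  have base'_a : ∀ v, B.base v = a → base' v = a := fun v hv => by simp [hbase', hv]
  have base'_o : ∀ v, v ∉ T → (G.trim T a hT).src (B.base v) ≠ G.tgt a → base' v = B.base v :=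
    fun v hv h => by simp [hbase', hv, h]
  have base'_congr : ∀ v x, v ∉ T → x ∉ T → B.base v = B.base x → base' v = base' x :=
    fun v x hv hx h => by simp [hbase', hv, hx, h]
  have hbs : ∀ v ∈ B.fragments, (G.trim T a hT).src (B.base v) ∈ B.inner := B.src_base
  have htb : ∀ v ∈ B.fragments, v ∉ T → (G.trim T a hT).src (B.base v) ≠ G.tgt a →
      G.src (B.base v) ∈ B.inner \ T := by
    intro v hv hvT h
    have h1 := hsrc_w _ (hbs v hv) h
    have h2 := hbs v hv
    rw [trim_src_of_notMem hw h1] at h2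
    exact ⟨h2, h1⟩
  have cases_base : ∀ v ∈ B.fragments ∪ T, base' v = a ∨
      (v ∈ B.fragments ∧ v ∉ T ∧ (G.trim T a hT).src (B.base v) ≠ G.tgt a ∧
        base' v = B.base v) := by
    intro v hv
    by_cases h1 : v ∈ T
    · exact Or.inl (base'_T v h1)
    by_cases h2 : (G.trim T a hT).src (B.base v) = G.tgt a
    · exact Or.inl (base'_w v h2)
    · exact Or.inr ⟨hv.resolve_right h1, h1, h2, base'_o v h1 h2⟩
  refine ⟨⟨B.inner \ T, B.fragments ∪ T, base', ?_, ?_, ?_, ?_, ?_, ?_, ?_, ?_, ?_⟩, rfl⟩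
  · exact fun v hv h => hinner v hv.1 h.1
  · exact fun v hv h => h.elim (B.notMem_fragments v hv.1) hv.2
  · exact fun v hv => hv.imp (hmate v) (hT v)
  · intro v hv
    by_cases h1 : v ∈ T
    · rw [base'_T v h1, base'_T _ (hT v h1)]
    · exact base'_congr _ _ (fun h => h1 (mem_of_mate_mem hT h)) h1
        (hbase v (hv.resolve_right h1))
  · rintro b hb ⟨h1, h2⟩
    have hbO := mem_outer b hb fun h => h2 h.1
    have key := B.leave_inner b hbO (by rwa [trim_src_of_notMem hw h2])
    by_cases h3 : G.tgt b ∈ T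
    · refine Or.inr ⟨Or.inr h3, ?_⟩
      rw [base'_T _ h3]
      -- Any other arc into `T` would enter the mate of `w` from the inner part, hence be the base
      -- of its fragment; but that base is `a`.
      by_contra hba
      rw [trim_tgt_of_mem h3 (Ne.symm hba)] at key
      rcases key with h | h
      · exact hw'B h
      · exact hba ((hw_frag h.1).symm.trans h.2)
    · rw [trim_tgt_of_notMem hw h3] at key
      rcases key with h | h
      · exact Or.inl ⟨h, h3⟩
      · refine Or.inr ⟨Or.inl h.1, ?_⟩
        rw [base'_o _ h3, h.2]
        rw [h.2, trim_src_of_notMem hw h2]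
        exact fun h' => h2 (h' ▸ hw)
  · intro b hb hsrc
    by_cases h1 : G.src b ∈ T
    · by_cases h2 : G.tgt b ∈ T
      · exact Or.inr (Or.inr ⟨Or.inr h2, by rw [base'_T _ h1, base'_T _ h2]⟩)
      by_cases hba : b = G.arcMate a
      · refine Or.inr (Or.inl ?_)
        rw [hba, G.tgt_arcMate, G.nodeMate_nodeMate]
        exact ⟨haB, haT⟩
      have hbO := mem_outer b hb fun h => h2 h.2
      have hs := trim_src_of_mem (hT := hT) h1 hba
      have ht := trim_tgt_of_notMem (hT := hT) hw h2
      rcases hwB with h | h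
      · have key := B.leave_inner b hbO (by rwa [hs])
        rw [ht] at key
        rcases key with k | k
        · exact Or.inl ⟨k, h2⟩
        · exact Or.inr (Or.inr ⟨Or.inl k.1,
            by rw [base'_T _ h1, base'_w _ (by rw [k.2, hs])]⟩)
      · have key := B.leave_fragment b hbO (by rw [hs]; exact h.1)
        rw [ht, hs] at key
        rcases key with k | k | k
        · exact Or.inl ⟨k, h2⟩
        · exact Or.inr (Or.inl ⟨k, fun h => h2 (mem_of_mate_mem hT h)⟩)
        · exact Or.inr (Or.inr ⟨Or.inl k.1,
            by rw [base'_T _ h1, base'_a _ (k.2.trans h.2)]⟩)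
    · have hX := hsrc.resolve_right h1
      have hbO := mem_outer b hb fun h => h1 h.1
      have hs := trim_src_of_notMem (hT := hT) hw h1
      have key := B.leave_fragment b hbO (by rwa [hs])
      by_cases h2 : G.tgt b ∈ T
      · refine Or.inr (Or.inr ⟨Or.inr h2, ?_⟩)
        rw [base'_T _ h2]
        have hba : b ≠ a := by
          rintro rfl
          exact B.notMem_fragments _ haB hX
        have ht := trim_tgt_of_mem (hT := hT) h2 hba
        rw [ht, hs] at key
        symm
        rcases key with k | k | k
        · exact absurd k hw'B
        · change G.nodeMate (G.nodeMate (G.tgt a)) ∈ B.inner at k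
          rw [G.nodeMate_nodeMate] at k
          have hs' : (G.trim T a hT).src (G.arcMate b) = G.tgt a := by
            have := (G.trim T a hT).src_arcMate b
            rw [ht] at this
            exact this.trans (G.nodeMate_nodeMate _)
          have ht' : (G.trim T a hT).tgt (G.arcMate b) = G.nodeMate (G.src b) := by
            have := (G.trim T a hT).tgt_arcMate b
            rw [hs] at this
            exact this
          -- Here `w` is inner and the mate of `b` leaves it, so the fragment containing the tail of
          -- `b` has a base leaving `w` and is merged with `T`.
          have key := B.leave_inner _ (mate_mem_outerArcs hT hS hbO) (by rwa [hs'])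
          rw [ht'] at key
          rcases key with k' | k'
          · exact absurd (hmate _ hX) (B.notMem_fragments _ k')
          · apply base'_w
            rw [← hbase _ hX, k'.2, hs']
        · exact base'_a _ (k.2.symm.trans (hw_frag k.1))
      · have ht := trim_tgt_of_notMem (hT := hT) hw h2
        rw [ht, hs] at key
        rcases key with k | k | k
        · exact Or.inl ⟨k, h2⟩
        · exact Or.inr (Or.inl ⟨k, fun h => h2 (mem_of_mate_mem hT h)⟩)
        · exact Or.inr (Or.inr ⟨Or.inl k.1, base'_congr _ _ h2 h1 k.2⟩)
  · intro v hv
    rcases cases_base v hv with h | ⟨h1, -, -, h⟩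
    · rwa [h]
    · rw [h]
      exact (mem_outerArcs.1 (B.base_mem v h1)).1
  · intro v hv
    rcases cases_base v hv with h | ⟨h1, h2, h3, h⟩
    · rw [h]
      exact ⟨haB, haT⟩
    · rw [h]
      exact htb v h1 h2 h3
  · intro v hv
    rcases cases_base v hv with h | ⟨h1, h2, h3, h⟩
    · rw [h]
      exact Or.inr hw
    · rw [h]
      by_cases h4 : G.tgt (B.base v) ∈ T
      · exact Or.inr h4
      · have := B.tgt_base v h1
        rw [trim_tgt_of_notMem hw h4] at this
        exact Or.inl this

end Trim

/-! ### Regular reachability. -/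

open Classical in
/-- Regular reachability: either a regular walk leads from `A` to the mate of `A`, or a
barrier separates them. -/
theorem exists_regularWalk_or_barrier [Nonempty E] (G : SkewSymmetricGraph V E) (S : Finset E)
    (hS : ∀ b ∈ S, G.arcMate b ∈ S) (A : Set V) (hA : ∀ v ∈ A, G.nodeMate v ∉ A) :
    (∃ x ∈ A, ∃ y ∈ A, ∃ l, G.IsRegularWalk S x l (G.nodeMate y)) ∨
      ∃ B : G.Barrier S, A ⊆ B.inner := by
  induction hn : S.card using Nat.strong_induction_on generalizing G S A with
  | _ n ih =>
  subst hn
  by_cases hout : ∀ b ∈ S, G.src b ∈ A → G.tgt b ∈ A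
  · right
    exact ⟨⟨A, ∅, fun _ => Classical.arbitrary E, hA, by simp, by simp, by simp,
      fun b hb h => Or.inl (hout b hb h), by simp, by simp, by simp, by simp⟩, le_rfl⟩
  push Not at hout
  obtain ⟨a, haS, hpA, hwA⟩ := hout
  have haS' := hS a haS
  set w := G.tgt a with hw
  by_cases hwA' : G.nodeMate w ∈ A
  · left
    refine ⟨_, hpA, _, hwA', [a], ?_⟩
    rw [G.nodeMate_nodeMate]
    exact IsRegularWalk.single haS
  set S₁ := (S.erase a).erase (G.arcMate a) with hS₁
  have hsub : S₁ ⊆ S := fun b hb => Finset.mem_of_mem_erase (Finset.mem_of_mem_erase hb)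
  have hS₁m : ∀ b ∈ S₁, G.arcMate b ∈ S₁ := by
    intro b hb
    simp only [hS₁, Finset.mem_erase] at hb ⊢
    refine ⟨fun h => hb.2.1 (G.arcMate_injective h), fun h => hb.1 (G.arcMate_eq_comm.1 h),
      hS b hb.2.2⟩
  have hne : ∀ b ∈ S₁, a ≠ b ∧ G.arcMate a ≠ b := by
    intro b hb
    simp only [hS₁, Finset.mem_erase] at hb
    exact ⟨Ne.symm hb.2.1, Ne.symm hb.1⟩
  have hne' : ∀ b ∈ S₁, b ≠ G.arcMate a ∧ G.arcMate b ≠ G.arcMate a := by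
    intro b hb
    exact ⟨(hne b hb).2.symm, fun h => (hne b hb).1 (G.arcMate_injective h).symm⟩
  have hcard : S₁.card < S.card :=
    Finset.card_lt_card ⟨hsub, fun h => (hne a (h haS)).1 rfl⟩
  have prepend : ∀ {y l}, G.IsRegularWalk S₁ w l y → G.IsRegularWalk S (G.src a) (a :: l) y := by
    intro y l h
    refine (IsRegularWalk.single haS).append (h.mono hsub) ?_
    intro c hc d hd
    rw [List.mem_singleton.1 hc]
    exact hne d (h.mem d hd)
  have append : ∀ {x l}, G.IsRegularWalk S₁ x l (G.nodeMate w) →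
      G.IsRegularWalk S x (l ++ [G.arcMate a]) (G.nodeMate (G.src a)) := by
    intro x l h
    have h1 := IsRegularWalk.single (G := G) haS'
    rw [G.src_arcMate, G.tgt_arcMate] at h1
    refine (h.mono hsub).append h1 ?_
    intro c hc d hd
    rw [List.mem_singleton.1 hd]
    exact hne' c (h.mem c hc)
  have hAw : ∀ v ∈ insert w A, G.nodeMate v ∉ insert w A := by
    rintro v (rfl | hv) (h | h)
    · exact G.nodeMate_ne _ h
    · exact hwA' h
    · rw [G.nodeMate_eq_comm] at h
      exact hwA' (h ▸ hv)
    · exact hA v hv h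
  rcases ih _ hcard G S₁ hS₁m (insert w A) hAw rfl with ⟨x, hx, y, hy, P, hP⟩ | ⟨B, hB⟩
  swap
  -- Restoring `a` and its mate does no harm: `a` runs inside the inner part, and its mate runs
  -- between mates of inner nodes.
  · right
    refine ⟨⟨B.inner, B.fragments, B.base, B.mate_notMem_inner, B.notMem_fragments,
      B.mate_mem_fragments, B.base_mate, ?_, ?_, fun v hv => hsub (B.base_mem v hv), B.src_base,
      B.tgt_base⟩, (Set.subset_insert _ _).trans hB⟩
    · intro b hb h
      by_cases h1 : b = a
      · rw [h1]
        exact Or.inl (hB (Set.mem_insert _ _))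
      by_cases h2 : b = G.arcMate a
      · rw [h2, G.src_arcMate] at h
        exact absurd h (B.mate_notMem_inner _ (hB (Set.mem_insert _ _)))
      exact B.leave_inner b (by simp [hS₁, h1, h2, hb]) h
    · intro b hb h
      by_cases h1 : b = a
      · rw [h1] at h
        exact absurd h (B.notMem_fragments _ (hB (Set.mem_insert_of_mem _ hpA)))
      by_cases h2 : b = G.arcMate a
      · rw [h2, G.tgt_arcMate, G.nodeMate_nodeMate]
        exact Or.inr (Or.inl (hB (Set.mem_insert_of_mem _ hpA)))
      exact B.leave_fragment b (by simp [hS₁, h1, h2, hb]) h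
  rcases hx with rfl | hx
  swap
  · left
    rcases hy with rfl | hy
    · exact ⟨x, hx, _, hpA, _, append hP⟩
    · exact ⟨x, hx, y, hy, _, hP.mono hsub⟩
  rcases hy with rfl | hy
  swap
  · exact Or.inl ⟨_, hpA, y, hy, _, prepend hP⟩
  -- What remains is a regular walk `P` from `w` to its mate. If it meets `A` or the mate of `A`, a
  -- suffix followed by the mate of `a`, or a prefix preceded by `a`, is the required walk.
  set N : Set V := {v | ∃ l₁ l₂, P = l₁ ++ l₂ ∧ G.IsWalk w l₁ v ∧ G.IsWalk v l₂ (G.nodeMate w)}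
    with hN
  have hwN : w ∈ N := ⟨[], P, rfl, rfl, hP.walk⟩
  by_cases hNA : ∃ v ∈ N, v ∈ A ∨ G.nodeMate v ∈ A
  · left
    obtain ⟨v, ⟨l₁, l₂, rfl, h1, h2⟩, hv⟩ := hNA
    have hsplit := hP.of_append h1 h2
    rcases hv with hv | hv
    · exact ⟨v, hv, _, hpA, _, append hsplit.2⟩
    · refine ⟨_, hpA, _, hv, a :: l₁, ?_⟩
      rw [G.nodeMate_nodeMate]
      exact prepend hsplit.1
  push Not at hNA
  set T : Set V := {v | v ∈ N ∨ G.nodeMate v ∈ N} with hTdef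
  have hT : ∀ v ∈ T, G.nodeMate v ∈ T := by
    rintro v (h | h)
    · exact Or.inr (by rwa [G.nodeMate_nodeMate])
    · exact Or.inl h
  have hTA : ∀ v ∈ T, v ∉ A ∧ G.nodeMate v ∉ A := by
    rintro v (h | h)
    · exact hNA v h
    · have := hNA _ h
      rw [G.nodeMate_nodeMate] at this
      exact this.symm
  have hwT : G.tgt a ∈ T := Or.inl hwN
  have haT : G.src a ∉ T := fun h => (hTA _ h).1 hpA
  have hPin : ∀ b ∈ P, b ∈ G.innerArcs T S := by
    intro b hb
    obtain ⟨l₁, l₂, hl⟩ := List.append_of_mem hb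
    have hwalk := hP.walk
    rw [hl] at hwalk
    obtain ⟨v, h1, rfl, h2⟩ := (isWalk_append _).1 hwalk
    refine mem_innerArcs.2 ⟨hsub (hP.mem b hb), Or.inl ⟨l₁, _, hl, h1, rfl, h2⟩,
      Or.inl ⟨l₁ ++ [b], l₂, by simp [hl], ?_, h2⟩⟩
    exact (isWalk_append _).2 ⟨_, h1, rfl, rfl⟩
  have hin_mate : ∀ b ∈ G.innerArcs T S, G.arcMate b ∈ G.innerArcs T S := by
    intro b hb
    rw [mem_innerArcs] at hb ⊢
    rw [G.src_arcMate, G.tgt_arcMate]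
    exact ⟨hS b hb.1, hT _ hb.2.2, hT _ hb.2.1⟩
  have hPreg : G.IsRegularWalk (G.innerArcs T S) w P (G.nodeMate w) := ⟨hP.walk, hPin, hP.pairwise⟩
  have hreach : ∀ x ∈ T, ∃ l, G.IsRegularWalk (G.innerArcs T S) (G.tgt a) l x := by
    rintro x (⟨l₁, l₂, hl, h1, h2⟩ | ⟨l₁, l₂, hl, h1, h2⟩)
    · rw [hl] at hPreg
      exact ⟨l₁, (hPreg.of_append h1 h2).1⟩
    · rw [hl] at hPreg
      have := (hPreg.of_append h1 h2).2.mate hin_mate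
      rw [G.nodeMate_nodeMate, G.nodeMate_nodeMate] at this
      exact ⟨_, this⟩
  -- `P` is nonempty, as no node is its own mate, and all its arcs vanish in the contraction.
  have hcard' : (G.outerArcs T S).card < S.card := by
    refine Finset.card_lt_card ⟨fun b hb => (mem_outerArcs.1 hb).1, fun h => ?_⟩
    cases P with
    | nil => exact G.nodeMate_ne w (show w = G.nodeMate w from hP.walk).symm
    | cons b l =>
      have hb := mem_innerArcs.1 (hPin b (by simp))
      exact (mem_outerArcs.1 (h hb.1)).2 hb.2
  rcases ih _ hcard' (G.trim T a hT) (G.outerArcs T S)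
    (fun b hb => mate_mem_outerArcs hT hS hb) A hA rfl with ⟨x, hx, y, hy, l, hl⟩ | ⟨B, hB⟩
  · left
    refine ⟨x, hx, y, hy, exists_regularWalk_of_trim hS haT hwT hreach (fun h => (hTA _ h).1 hx)
      (fun h => (hTA _ h).2 ?_) hl⟩
    rwa [G.nodeMate_nodeMate]
  · right
    obtain ⟨B', hB'⟩ := exists_barrier_of_trim hS haS haT hwT B (hB hpA)
    exact ⟨B', hB' ▸ fun v hv => ⟨hB hv, fun h => (hTA v h).1 hv⟩⟩

end SkewSymmetricGraph

/-! ### Residual graphs and augmentation. -/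

namespace SkewSymmetricGraph

variable {V E : Type*}

open Classical in
theorem IsWalk.sum_boundary {G : SkewSymmetricGraph V E} {v w : V} {l : List E}
    (h : G.IsWalk v l w) (x : V) :
    (l.map fun b => ((if G.src b = x then 1 else 0) - (if G.tgt b = x then 1 else 0) : ℝ)).sum =
      (if v = x then 1 else 0) - (if w = x then 1 else 0) := by
  induction l generalizing v with
  | nil =>
    obtain rfl : v = w := h
    simp
  | cons a l ih =>
    obtain ⟨rfl, h⟩ := h
    simp [ih h]

/-- This is what allows augmenting along a regular walk and its mate simultaneously. -/
theorem IsRegularWalk.nodup_append_mate {G : SkewSymmetricGraph V E} {S : Finset E} {v w : V}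
    {l : List E} (h : G.IsRegularWalk S v l w) : (l ++ (l.map G.arcMate).reverse).Nodup := by
  have hl : l.Nodup := h.pairwise.imp fun h => h.1
  refine List.nodup_append.2 ⟨hl, List.nodup_reverse.2 (hl.map G.arcMate_injective), ?_⟩
  intro a ha b hb
  simp only [List.mem_reverse, List.mem_map] at hb
  obtain ⟨c, hc, rfl⟩ := hb
  by_cases hac : a = c
  · rw [hac]
    exact (G.arcMate_ne c).symm
  have hsymm : Std.Symm (fun a b => a ≠ b ∧ G.arcMate a ≠ b) :=
    ⟨fun a b h => ⟨h.1.symm, fun e => h.2 (G.arcMate_eq_comm.1 e ▸ rfl)⟩⟩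
  have := h.pairwise.forall ha hc hac
  exact fun e => this.2 (by rw [e, G.arcMate_arcMate])

theorem sum_arcMate [Fintype E] (G : SkewSymmetricGraph V E) {M : Type*} [AddCommMonoid M]
    (h : E → M) : ∑ a, h (G.arcMate a) = ∑ a, h a :=
  Equiv.sum_comp (Function.Involutive.toPerm G.arcMate G.arcMate_arcMate) h

end SkewSymmetricGraph

namespace SkewSymmetricNetwork

variable {V E : Type*}

open Classical in
theorem divergence_eq_sum [Fintype E] (N : SkewSymmetricNetwork V E) (f : E → ℝ) (x : V) :
    N.divergence f x =
      ∑ a, f a * ((if N.src a = x then 1 else 0) - (if N.tgt a = x then 1 else 0)) := by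
  simp only [divergence, mul_sub, mul_ite, mul_one, mul_zero, Finset.sum_sub_distrib,
    Finset.sum_filter]

/-- The residual graph of an integer symmetric flow `n`, with the arc `a` split into unit arcs
`⟨a, i⟩`, of which those with `i < n a` are reversed. -/
def residual (N : SkewSymmetricNetwork V E) (n : E → ℕ) (hn : ∀ a, n (N.arcMate a) = n a) :
    SkewSymmetricGraph V (Σ _ : E, ℕ) where
  src b := if b.2 < n b.1 then N.tgt b.1 else N.src b.1
  tgt b := if b.2 < n b.1 then N.src b.1 else N.tgt b.1
  nodeMate := N.nodeMate
  arcMate b := ⟨N.arcMate b.1, b.2⟩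
  nodeMate_ne := N.nodeMate_ne
  arcMate_ne b h := N.arcMate_ne b.1 (congrArg Sigma.fst h)
  nodeMate_nodeMate := N.nodeMate_nodeMate
  arcMate_arcMate b := by simp [N.arcMate_arcMate]
  src_arcMate b := by
    simp only [hn, N.src_arcMate, N.tgt_arcMate]
    split_ifs <;> rfl
  tgt_arcMate b := by
    simp only [hn, N.src_arcMate, N.tgt_arcMate]
    split_ifs <;> rfl

/-- The unit arcs `⟨a, i⟩` with `i < n a`. -/
def unitArcs [Fintype E] (n : E → ℕ) : Finset (Σ _ : E, ℕ) :=
  Finset.univ.sigma fun a => Finset.range (n a)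

theorem mem_unitArcs [Fintype E] {n : E → ℕ} {b : Σ _ : E, ℕ} :
    b ∈ unitArcs n ↔ b.2 < n b.1 := by
  simp [unitArcs]

theorem sum_unitArcs_apply [Fintype E] {M : Type*} [AddCommMonoid M] (n : E → ℕ)
    (h : (Σ _ : E, ℕ) → M) :
    ∑ b ∈ unitArcs n, h b = ∑ a, ∑ i ∈ Finset.range (n a), h ⟨a, i⟩ :=
  Finset.sum_sigma _ _ _

theorem sum_unitArcs [Fintype E] (n : E → ℕ) (h : E → ℝ) :
    ∑ b ∈ unitArcs n, h b.1 = ∑ a, n a * h a := by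
  simp [sum_unitArcs_apply]

open Classical in
theorem exists_flow_of_regularWalk [Fintype E] (N : SkewSymmetricNetwork V E) {n : E → ℕ}
    (hn : ∀ a, n (N.arcMate a) = n a) (hf : N.IsISFlow fun a => (n a : ℝ)) {l}
    (hl : (N.residual n hn).IsRegularWalk (unitArcs N.cap) N.source l N.sink) :
    ∃ g, N.IsISFlow g ∧ N.value (fun a => (n a : ℝ)) < N.value g := by
  set R := N.residual n hn with hR
  set L := l ++ (l.map R.arcMate).reverse with hL
  set F := unitArcs n with hF
  set T := L.toFinset with hT
  have hcapm : ∀ b ∈ unitArcs N.cap, R.arcMate b ∈ unitArcs N.cap := by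
    intro b hb
    rw [mem_unitArcs] at hb ⊢
    simpa [hR, residual, N.cap_arcMate] using hb
  have hTcap : T ⊆ unitArcs N.cap := by
    intro b hb
    simp only [hT, hL, List.mem_toFinset, List.mem_append] at hb
    exact hb.elim (hl.mem b) ((hl.mate hcapm).mem b)
  have hle : ∀ a, n a ≤ N.cap a := fun a => by exact_mod_cast hf.le_cap a
  have hFcap : F ⊆ unitArcs N.cap := by
    intro b hb
    rw [hF, mem_unitArcs] at hb
    exact mem_unitArcs.2 (hb.trans_le (hle _))
  have hTm : ∀ b, R.arcMate b ∈ T ↔ b ∈ T := by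
    have : ∀ b, b ∈ T → R.arcMate b ∈ T := by
      intro b hb
      simp only [hT, hL, List.mem_toFinset, List.mem_append, List.mem_reverse,
        List.mem_map] at hb ⊢
      rcases hb with hb | ⟨c, hc, rfl⟩
      · exact Or.inr ⟨b, hb, rfl⟩
      · exact Or.inl (by rwa [R.arcMate_arcMate])
    exact fun b => ⟨fun h => by simpa [R.arcMate_arcMate] using this _ h, this b⟩
  have hFm : ∀ b, R.arcMate b ∈ F ↔ b ∈ F := by
    intro b
    rw [hF, mem_unitArcs, mem_unitArcs]
    simp [hR, residual, hn]
  have hTsum : ∀ x, ∑ b ∈ T, ((if R.src b = x then 1 else 0) - (if R.tgt b = x then 1 else 0) : ℝ)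
      = 2 * ((if N.source = x then 1 else 0) - (if N.sink = x then 1 else 0)) := by
    intro x
    rw [hT, List.sum_toFinset _ hl.nodup_append_mate, List.map_append, List.sum_append,
      hl.walk.sum_boundary, hl.walk.mate.sum_boundary]
    have h1 : R.nodeMate N.sink = N.source := N.nodeMate_nodeMate _
    have h2 : R.nodeMate N.source = N.sink := rfl
    rw [h1, h2]
    ring
  -- Augmentation toggles the occupied units along the walk and its mate. The new flow only counts
  -- occupied units, so they need not form an initial segment.
  set D := symmDiff F T with hD
  set g : E → ℕ := fun a => (D.filter fun b => b.1 = a).card with hg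
  have hdiv : ∀ x, N.divergence (fun a => (g a : ℝ)) x = N.divergence (fun a => (n a : ℝ)) x +
      2 * ((if N.source = x then 1 else 0) - (if N.sink = x then 1 else 0)) := by
    intro x
    rw [← hTsum, divergence_eq_sum, divergence_eq_sum]
    set h : E → ℝ := fun a => (if N.src a = x then 1 else 0) - (if N.tgt a = x then 1 else 0)
      with hh
    have e1 : ∑ a, (g a : ℝ) * h a = ∑ b ∈ D, h b.1 := by
      rw [← Finset.sum_fiberwise D (fun b => b.1)]
      refine Finset.sum_congr rfl fun a _ => ?_
      rw [Finset.sum_congr rfl (g := fun _ => h a)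
        (fun b hb => by rw [(Finset.mem_filter.1 hb).2])]
      simp [hg]
    have e2 : ∀ b ∈ T, ((if R.src b = x then 1 else 0) - (if R.tgt b = x then 1 else 0) : ℝ)
        = if b ∈ F then - h b.1 else h b.1 := by
      intro b _
      simp only [hF, mem_unitArcs, hR, residual, hh]
      by_cases hb : b.2 < n b.1 <;> simp [hb]
    rw [e1, Finset.sum_congr rfl e2, ← sum_unitArcs n h, ← hF, hD, symmDiff_def,
      Finset.sup_eq_union, Finset.sum_union, Finset.sum_ite, Finset.sum_neg_distrib,
      ← Finset.sum_inter_add_sum_sdiff F T (f := fun b => h b.1)]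
    · have e3 : T.filter (fun b => b ∈ F) = F ∩ T := by ext; simp [and_comm]
      have e4 : T.filter (fun b => b ∉ F) = T \ F := by ext; simp
      rw [e3, e4]
      ring
    · exact disjoint_sdiff_sdiff
  have hsv : N.sink ≠ N.source := N.nodeMate_ne _
  refine ⟨fun a => (g a : ℝ), ⟨⟨fun a => Nat.cast_nonneg _, fun a => ?_, fun x h1 h2 => ?_⟩,
    fun a => ?_, fun a => ⟨g a, by simp⟩⟩, ?_⟩
  · have : g a ≤ (((Finset.range (N.cap a)).map
        ⟨fun i => (⟨a, i⟩ : Σ _ : E, ℕ), fun i j h => by simpa using h⟩)).card := by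
      refine Finset.card_le_card fun b hb => ?_
      obtain ⟨hbD, rfl⟩ := Finset.mem_filter.1 hb
      have : b ∈ unitArcs N.cap := by
        rcases Finset.mem_symmDiff.1 hbD with h | h
        · exact hFcap h.1
        · exact hTcap h.1
      rw [mem_unitArcs] at this
      simp only [Finset.mem_map, Finset.mem_range]
      exact ⟨b.2, this, rfl⟩
    rw [Finset.card_map, Finset.card_range] at this
    exact_mod_cast this
  · rw [hdiv, hf.conservation x h1 h2]
    simp [Ne.symm h1, Ne.symm h2]
  · have hDm : ∀ b, R.arcMate b ∈ D ↔ b ∈ D := by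
      intro b
      simp only [hD, Finset.mem_symmDiff, hFm, hTm]
    congr 1
    refine Finset.card_bij (fun b _ => R.arcMate b) ?_ ?_ ?_
    · intro b hb
      simp only [Finset.mem_filter] at hb ⊢
      exact ⟨(hDm b).2 hb.1, congrArg N.arcMate hb.2⟩
    · exact fun b _ c _ h => R.arcMate_injective h
    · intro b hb
      simp only [Finset.mem_filter] at hb
      refine ⟨R.arcMate b, ?_, R.arcMate_arcMate b⟩
      simp only [Finset.mem_filter]
      exact ⟨(hDm b).2 hb.1, N.arcMate_eq_comm.2 hb.2⟩
  · rw [value, value, hdiv]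
    simp [hsv]

theorem IsISFlow.exists_nat [Fintype E] {N : SkewSymmetricNetwork V E} {f : E → ℝ}
    (hf : N.IsISFlow f) : ∃ n : E → ℕ, f = fun a => (n a : ℝ) := by
  have : ∀ a, ∃ k : ℕ, f a = k := by
    intro a
    obtain ⟨k, hk⟩ := hf.integral a
    have h0 : 0 ≤ k := by exact_mod_cast hk ▸ hf.nonneg a
    lift k to ℕ using h0
    exact ⟨k, by simpa using hk⟩
  choose n hn using this
  exact ⟨n, funext hn⟩

theorem IsMaximumISFlow.exists_barrier [Fintype E] [Nonempty E] {N : SkewSymmetricNetwork V E}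
    {n : E → ℕ} (hn : ∀ a, n (N.arcMate a) = n a) (hf : N.IsMaximumISFlow fun a => (n a : ℝ)) :
    ∃ B : (N.residual n hn).Barrier (unitArcs N.cap), N.source ∈ B.inner := by
  have : Nonempty (Σ _ : E, ℕ) := ⟨⟨Classical.arbitrary E, 0⟩⟩
  rcases (N.residual n hn).exists_regularWalk_or_barrier (unitArcs N.cap) (fun b hb => by
      rw [mem_unitArcs] at hb ⊢
      simpa [residual, N.cap_arcMate] using hb) {N.source}
      (fun v hv h => N.nodeMate_ne N.source (by
        obtain rfl : v = N.source := hv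
        exact h)) with
    ⟨x, rfl, y, rfl, l, hl⟩ | ⟨B, hB⟩
  · obtain ⟨g, hg, hlt⟩ := N.exists_flow_of_regularWalk hn hf.1 hl
    exact absurd (hf.2 g hg) hlt.not_ge
  · exact ⟨B, hB rfl⟩

theorem exists_isMaximumISFlow [Fintype E] (N : SkewSymmetricNetwork V E) :
    ∃ f, N.IsMaximumISFlow f := by
  have hfin : {f | N.IsISFlow f}.Finite := by
    refine (Set.Finite.pi (t := fun a => (fun k : ℕ => (k : ℝ)) '' Set.Iic (N.cap a))
      (fun a => (Set.finite_Iic _).image _)).subset ?_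
    intro f hf a _
    obtain ⟨n, rfl⟩ := IsISFlow.exists_nat hf
    exact ⟨n a, by exact_mod_cast hf.le_cap a, rfl⟩
  have hne : {f | N.IsISFlow f}.Nonempty := by
    refine ⟨fun _ => 0, ⟨⟨fun _ => le_rfl, fun _ => Nat.cast_nonneg _, fun x _ _ => ?_⟩,
      fun _ => rfl, fun _ => ⟨0, by simp⟩⟩⟩
    simp [divergence]
  obtain ⟨f, hf, hmax⟩ := Set.exists_max_image _ N.value hfin hne
  exact ⟨f, hf, hmax⟩

end SkewSymmetricNetwork

/-! ### Cuts, parity and the odd-fragment constraints. -/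

namespace SkewSymmetricNetwork

variable {V E : Type*}

theorem OddFragment.nodeMate_mem {N : SkewSymmetricNetwork V E} (ρ : N.OddFragment) {v : V} : N.nodeMate v ∈ ρ.nodes ↔ v ∈ ρ.nodes := by
  have h : ∀ v ∈ ρ.nodes, N.nodeMate v ∈ ρ.nodes := fun v hv => by
    rw [← ρ.nodes_symm]
    exact ⟨v, hv, rfl⟩
  exact ⟨fun hv => by simpa [N.nodeMate_nodeMate] using h _ hv, h v⟩

variable [Fintype E]

open Classical in
theorem sum_mul_cut [Fintype V] (N : SkewSymmetricNetwork V E) (g : E → ℝ) (A : Set V) :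
    ∑ a, g a * ((if N.src a ∈ A then 1 else 0) - (if N.tgt a ∈ A then 1 else 0)) =
      ∑ x with x ∈ A, N.divergence g x := by
  simp only [divergence_eq_sum]
  rw [Finset.sum_comm]
  refine Finset.sum_congr rfl fun a _ => ?_
  rw [← Finset.mul_sum, Finset.sum_sub_distrib]
  simp

open Classical in
theorem IsFlow.sum_mul_cut_eq_value [Fintype V] {N : SkewSymmetricNetwork V E} {g : E → ℝ}
    (hg : N.IsFlow g) {A : Set V} (hs : N.source ∈ A) (hs' : N.sink ∉ A) :
    ∑ a, g a * ((if N.src a ∈ A then 1 else 0) - (if N.tgt a ∈ A then 1 else 0)) = N.value g := by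
  rw [sum_mul_cut, Finset.sum_eq_single N.source]
  · rfl
  · intro x hx hne
    exact hg.conservation x hne fun h => hs' (h ▸ (Finset.mem_filter.1 hx).2)
  · intro h
    simp [hs] at h

theorem divergence_comp_arcMate (N : SkewSymmetricNetwork V E) (g : E → ℝ) (x : V) :
    N.divergence (fun a => g (N.arcMate a)) x = -N.divergence g (N.nodeMate x) := by
  classical
  rw [divergence_eq_sum, divergence_eq_sum, ← Finset.sum_neg_distrib, ← N.sum_arcMate]
  refine Finset.sum_congr rfl fun a _ => ?_
  simp only [N.arcMate_arcMate, N.src_arcMate, N.tgt_arcMate, N.nodeMate_eq_comm]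
  ring

theorem IsFlow.comp_arcMate {N : SkewSymmetricNetwork V E} {g : E → ℝ} (hg : N.IsFlow g) :
    N.IsFlow fun a => g (N.arcMate a) where
  nonneg a := hg.nonneg _
  le_cap a := by simpa [N.cap_arcMate] using hg.le_cap (N.arcMate a)
  conservation x h1 h2 := by
    rw [divergence_comp_arcMate, hg.conservation, neg_zero]
    · exact fun h => h2 (N.nodeMate_eq_comm.1 h)
    · exact fun h => h1 (by simpa [sink, N.nodeMate_nodeMate] using N.nodeMate_eq_comm.1 h)

/-- All divergences sum to zero, so the sink absorbs what the source emits. -/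
theorem IsFlow.value_comp_arcMate [Fintype V] {N : SkewSymmetricNetwork V E} {g : E → ℝ}
    (hg : N.IsFlow g) : N.value (fun a => g (N.arcMate a)) = N.value g := by
  classical
  have h := N.sum_mul_cut g Set.univ
  have hne : N.source ≠ N.sink := (N.nodeMate_ne _).symm
  simp only [Set.mem_univ, if_true, sub_self, mul_zero, Finset.sum_const_zero,
    Finset.filter_true] at h
  rw [← Finset.sum_subset (Finset.subset_univ {N.source, N.sink}), Finset.sum_pair hne] at h
  · rw [value, divergence_comp_arcMate, value]
    change -N.divergence g N.sink = _
    linarith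
  · intro x _ hx
    simp only [Finset.mem_insert, Finset.mem_singleton, not_or] at hx
    exact hg.conservation x hx.1 hx.2

theorem outflow_eq_value (N : SkewSymmetricNetwork V E) (h : ∀ a, N.tgt a ≠ N.source)
    (f : E → ℝ) : N.outflow f = N.value f := by
  simp [outflow, value, divergence, h]

open Classical in
/-- The amount of an integer symmetric flow that enters a self-symmetric set is even. -/
theorem even_sum_entering [Fintype V] (N : SkewSymmetricNetwork V E) {n : E → ℕ}
    (hn : ∀ a, n (N.arcMate a) = n a) {Y : Set V} (hY : ∀ v ∈ Y, N.nodeMate v ∈ Y)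
    (hdiv : ∀ x ∈ Y, N.divergence (fun a => (n a : ℝ)) x = 0) :
    Even (∑ a with N.src a ∉ Y ∧ N.tgt a ∈ Y, n a) := by
  rw [← ZMod.natCast_eq_zero_iff_even, Nat.cast_sum]
  have hY' : ∀ v, N.nodeMate v ∈ Y ↔ v ∈ Y :=
    fun v => ⟨fun h => by simpa [N.nodeMate_nodeMate] using hY _ h, hY v⟩
  -- By conservation and symmetry a node and its mate have equal inflow, so they cancel modulo 2;
  -- below, arcs inside `Y` cancel against their mates.
  have hin : ∑ a with N.tgt a ∈ Y, (n a : ZMod 2) = 0 := by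
    have h1 : ∑ a with N.tgt a ∈ Y, (n a : ZMod 2) =
        ∑ x with x ∈ Y, ∑ a with N.tgt a = x, (n a : ZMod 2) := by
      rw [Finset.sum_filter, Finset.sum_congr rfl fun x _ => Finset.sum_filter _ _,
        Finset.sum_comm]
      refine Finset.sum_congr rfl fun a _ => ?_
      simp
    rw [h1]
    refine Finset.sum_involution (fun x _ => N.nodeMate x) ?_ (fun x _ _ => N.nodeMate_ne x) ?_
      (fun x _ => N.nodeMate_nodeMate x)
    · intro x hx
      have h2 : ∑ a with N.tgt a = N.nodeMate x, (n a : ZMod 2) =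
          ∑ a with N.src a = x, (n a : ZMod 2) := by
        rw [Finset.sum_filter, Finset.sum_filter, ← N.sum_arcMate]
        refine Finset.sum_congr rfl fun a _ => ?_
        simp only [hn, N.tgt_arcMate, N.nodeMate_eq_comm, N.nodeMate_nodeMate]
      have h3 : ∑ a with N.src a = x, n a = ∑ a with N.tgt a = x, n a := by
        have := hdiv x (Finset.mem_filter.1 hx).2
        rw [divergence, sub_eq_zero] at this
        exact_mod_cast this
      have h4 := congrArg (Nat.cast (R := ZMod 2)) h3
      push_cast at h4
      rw [h2, h4]
      exact CharTwo.add_self_eq_zero _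
    · intro x hx
      simpa [hY'] using hx
  have hinner : ∑ a with N.tgt a ∈ Y ∧ N.src a ∈ Y, (n a : ZMod 2) = 0 := by
    refine Finset.sum_involution (fun a _ => N.arcMate a) ?_ (fun a _ _ => N.arcMate_ne a) ?_
      (fun a _ => N.arcMate_arcMate a)
    · intro a _
      rw [hn]
      exact CharTwo.add_self_eq_zero _
    · intro a ha
      simpa [N.src_arcMate, N.tgt_arcMate, hY', and_comm] using ha
  rw [← Finset.sum_filter_add_sum_filter_not _ (fun a => N.src a ∈ Y), Finset.filter_filter,
    Finset.filter_filter, hinner, zero_add] at hin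
  simpa only [and_comm] using hin

/-- With U the chosen arcs and D all entering arcs, u(U) − n(U) + n(D \ U) is nonnegative, and odd
since n(D) is even; so it is at least 1. Symmetry doubles this. -/
theorem IsISFlow.satisfiesOddFragmentConstraints [Fintype V] {N : SkewSymmetricNetwork V E}
    {f : E → ℝ} (hf : N.IsISFlow f) : N.SatisfiesOddFragmentConstraints f := by
  classical
  intro ρ
  obtain ⟨n, rfl⟩ := hf.exists_nat
  have hn : ∀ a, n (N.arcMate a) = n a := fun a => by exact_mod_cast (hf.symmetric a).symm
  have hle : ∀ a, n a ≤ N.cap a := fun a => by exact_mod_cast hf.le_cap a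
  set D : Finset E := Finset.univ.filter fun a => N.src a ∉ ρ.nodes ∧ N.tgt a ∈ ρ.nodes with hD
  have hsub : ρ.arcs ⊆ D := fun a ha => by simpa [hD] using ρ.arcs_enter a ha
  have heven : Even (∑ a ∈ D, n a) := by
    refine N.even_sum_entering hn (fun v hv => ρ.nodeMate_mem.2 hv) fun x hx => ?_
    refine hf.conservation x (fun h => ρ.source_notMem (h ▸ hx)) fun h => ρ.source_notMem ?_
    rw [h] at hx
    exact ρ.nodeMate_mem.1 hx
  set d : E → ℝ := fun a => if a ∈ ρ.arcs then 1 else if a ∈ D then -1 else 0 with hd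
  have hchi : ∀ a, ρ.chi a = d a + d (N.arcMate a) := by
    intro a
    have hmate : (∃ b ∈ ρ.arcs, N.arcMate b = a) ↔ N.arcMate a ∈ ρ.arcs := by
      constructor
      · rintro ⟨b, hb, rfl⟩
        rwa [N.arcMate_arcMate]
      · exact fun h => ⟨_, h, N.arcMate_arcMate a⟩
    have h1 : a ∈ ρ.arcs → N.src a ∉ ρ.nodes ∧ N.tgt a ∈ ρ.nodes := ρ.arcs_enter a
    have h2 : N.arcMate a ∈ ρ.arcs → N.tgt a ∉ ρ.nodes ∧ N.src a ∈ ρ.nodes := by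
      intro h
      simpa [N.src_arcMate, N.tgt_arcMate, ρ.nodeMate_mem] using ρ.arcs_enter _ h
    simp only [OddFragment.chi, hmate, hd, hD, Finset.mem_filter, Finset.mem_univ, true_and,
      N.src_arcMate, N.tgt_arcMate, ρ.nodeMate_mem]
    by_cases h3 : N.src a ∈ ρ.nodes <;> by_cases h4 : N.tgt a ∈ ρ.nodes <;>
      by_cases h5 : a ∈ ρ.arcs <;> by_cases h6 : N.arcMate a ∈ ρ.arcs <;> simp_all
  have hsum : ∑ a, (n a : ℝ) * ρ.chi a =
      2 * ((∑ a ∈ ρ.arcs, n a : ℕ) - (∑ a ∈ D \ ρ.arcs, n a : ℕ)) := by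
    have h1 : ∑ a, (n a : ℝ) * d (N.arcMate a) = ∑ a, (n a : ℝ) * d a := by
      rw [← N.sum_arcMate fun a => (n a : ℝ) * d a]
      exact Finset.sum_congr rfl fun a _ => by rw [hn]
    have h2 : ∀ a, (n a : ℝ) * d a =
        (if a ∈ ρ.arcs then (n a : ℝ) else 0) - (if a ∈ D \ ρ.arcs then (n a : ℝ) else 0) := by
      intro a
      simp only [hd, Finset.mem_sdiff]
      by_cases h3 : a ∈ ρ.arcs <;> by_cases h4 : a ∈ D <;> simp [h3, h4]
    simp only [hchi, mul_add, Finset.sum_add_distrib, h1]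
    simp only [h2, Finset.sum_sub_distrib, Finset.sum_ite_mem, Finset.univ_inter, Nat.cast_sum]
    ring
  have hDsum := Finset.sum_sdiff hsub (f := n)
  have hcap : ∑ a ∈ ρ.arcs, n a ≤ ∑ a ∈ ρ.arcs, N.cap a := Finset.sum_le_sum fun a _ => hle a
  have hodd := ρ.odd_cap
  have key : ∑ a ∈ ρ.arcs, n a + 1 ≤ ∑ a ∈ ρ.arcs, N.cap a + ∑ a ∈ D \ ρ.arcs, n a := by
    rw [← hDsum] at heven
    obtain ⟨k, hk⟩ := heven
    obtain ⟨m, hm⟩ := hodd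
    omega
  have key' : ((∑ a ∈ ρ.arcs, n a : ℕ) : ℝ) + 1 ≤
      (∑ a ∈ ρ.arcs, (N.cap a : ℝ)) + (∑ a ∈ D \ ρ.arcs, n a : ℕ) := by
    exact_mod_cast key
  rw [hsum]
  linarith

end SkewSymmetricNetwork

/-! ### Barriers of the residual graph as optimality certificates. -/

namespace SkewSymmetricNetwork

variable {V E : Type*} [Fintype E]

section Barrier

variable {N : SkewSymmetricNetwork V E} {n : E → ℕ} {hn : ∀ a, n (N.arcMate a) = n a}
  (B : (N.residual n hn).Barrier (unitArcs N.cap))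

theorem barrier_mate_mem_fragments {v : V} : N.nodeMate v ∈ B.fragments ↔ v ∈ B.fragments := by
  have h : ∀ v ∈ B.fragments, N.nodeMate v ∈ B.fragments := B.mate_mem_fragments
  exact ⟨fun hv => by simpa [N.nodeMate_nodeMate] using h _ hv, h v⟩

theorem barrier_base_mate {v : V} (hv : v ∈ B.fragments) : B.base (N.nodeMate v) = B.base v :=
  B.base_mate v hv

theorem barrier_tgt_of_unsaturated {a : E} (ha : n a < N.cap a) (hs : N.src a ∈ B.inner) :
    N.tgt a ∈ B.inner ∨ N.tgt a ∈ B.fragments := by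
  -- Unit `n a` is the first unit not reversed.
  have := B.leave_inner ⟨a, n a⟩ (mem_unitArcs.2 ha) (by simpa [residual] using hs)
  simp only [residual, lt_irrefl, if_false] at this
  exact this.imp_right And.left

theorem barrier_src_of_pos {a : E} (hle : n a ≤ N.cap a) (ha : 0 < n a)
    (ht : N.tgt a ∈ B.inner) : N.src a ∈ B.inner ∨ N.src a ∈ B.fragments := by
  have := B.leave_inner ⟨a, 0⟩ (mem_unitArcs.2 (ha.trans_le hle)) (by simpa [residual, ha] using ht)
  simp only [residual, ha, if_true] at this
  exact this.imp_right And.left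

theorem barrier_tgt_of_src_mem_fragments {a : E} (ha : 0 < N.cap a)
    (hs : N.src a ∈ B.fragments) : N.tgt a ∈ B.inner ∨ N.nodeMate (N.tgt a) ∈ B.inner ∨
      (N.tgt a ∈ B.fragments ∧ B.base (N.tgt a) = B.base (N.src a)) := by
  -- If `a` carries flow, its unit 0 is reversed, but unit 0 of its mate then leaves the mate of the
  -- tail of `a`, in the same fragment.
  by_cases h : 0 < n a
  · have h' : 0 < n (N.arcMate a) := by rwa [hn]
    have key := B.leave_fragment ⟨N.arcMate a, 0⟩ (mem_unitArcs.2 (by simpa [N.cap_arcMate] using ha))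
      (by simpa only [residual, h', if_true, N.tgt_arcMate, barrier_mate_mem_fragments B] using hs)
    simp only [residual, h', if_true, N.tgt_arcMate, N.src_arcMate, N.nodeMate_nodeMate,
      barrier_mate_mem_fragments B] at key
    rcases key with h1 | h1 | h1
    · exact Or.inr (Or.inl h1)
    · exact Or.inl h1
    · rw [barrier_base_mate B h1.1, barrier_base_mate B hs] at h1
      exact Or.inr (Or.inr h1)
  · have key := B.leave_fragment ⟨a, 0⟩ (mem_unitArcs.2 ha) (by simpa [residual, h] using hs)
    simpa only [residual, h, if_false] using key

theorem barrier_src_of_tgt_mem_fragments {a : E} (ha : 0 < N.cap a)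
    (ht : N.tgt a ∈ B.fragments) : N.src a ∈ B.inner ∨ N.nodeMate (N.src a) ∈ B.inner ∨
      (N.src a ∈ B.fragments ∧ B.base (N.src a) = B.base (N.tgt a)) := by
  have key := barrier_tgt_of_src_mem_fragments B (a := N.arcMate a)
    (by simpa [N.cap_arcMate] using ha)
    (by simpa only [N.src_arcMate, barrier_mate_mem_fragments B] using ht)
  simp only [N.src_arcMate, N.tgt_arcMate, N.nodeMate_nodeMate,
    barrier_mate_mem_fragments B] at key
  rcases key with h1 | h1 | h1
  · exact Or.inr (Or.inl h1)
  · exact Or.inl h1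
  · rw [barrier_base_mate B h1.1, barrier_base_mate B ht] at h1
    exact Or.inr (Or.inr h1)

/-- The fragment with base arc `e`. -/
def fragment (e : Σ _ : E, ℕ) : Set V := {v | v ∈ B.fragments ∧ B.base v = e}

theorem nodeMate_mem_fragment {e : Σ _ : E, ℕ} {v : V} :
    N.nodeMate v ∈ fragment B e ↔ v ∈ fragment B e := by
  simp only [fragment, Set.mem_ofPred_eq, barrier_mate_mem_fragments B]
  exact and_congr_right fun h => by rw [barrier_base_mate B h]

open Classical in
/-- The arcs from the inner part of the barrier to a set. -/
noncomputable def enteringArcs (Y : Set V) : Finset E :=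
  Finset.univ.filter fun a => N.src a ∈ B.inner ∧ N.tgt a ∈ Y

open Classical in
/-- The arcs from a set to the inner part of the barrier. -/
noncomputable def leavingArcs (Y : Set V) : Finset E :=
  Finset.univ.filter fun a => N.src a ∈ Y ∧ N.tgt a ∈ B.inner

theorem mem_enteringArcs {Y : Set V} {a : E} :
    a ∈ enteringArcs B Y ↔ N.src a ∈ B.inner ∧ N.tgt a ∈ Y := by
  simp [enteringArcs]

theorem mem_leavingArcs {Y : Set V} {a : E} :
    a ∈ leavingArcs B Y ↔ N.src a ∈ Y ∧ N.tgt a ∈ B.inner := by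
  simp [leavingArcs]

open Classical in
/-- Exactly one residual unit arc leads from the inner part to a fragment. -/
theorem cap_enteringArcs_fragment (hle : ∀ a, n a ≤ N.cap a) {v : V} (hv : v ∈ B.fragments) :
    ∑ a ∈ enteringArcs B (fragment B (B.base v)), N.cap a +
        ∑ a ∈ leavingArcs B (fragment B (B.base v)), n a =
      ∑ a ∈ enteringArcs B (fragment B (B.base v)), n a + 1 := by
  obtain ⟨e, he⟩ : ∃ e, B.base v = e := ⟨_, rfl⟩
  have heS := he ▸ B.base_mem v hv
  have hes := he ▸ B.src_base v hv
  have het := he ▸ B.tgt_base v hv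
  rw [he]
  have h1 : ((unitArcs N.cap).filter fun b =>
      (N.residual n hn).src b ∈ B.inner ∧ (N.residual n hn).tgt b ∈ fragment B e) = {e} := by
    ext b
    simp only [Finset.mem_filter, Finset.mem_singleton]
    constructor
    · rintro ⟨hb, hs, ht⟩
      rcases B.leave_inner b hb hs with h | h
      · exact absurd ht.1 (B.notMem_fragments _ h)
      · exact h.2.symm.trans ht.2
    · rintro rfl
      refine ⟨heS, hes, het, ?_⟩
      rcases B.leave_inner _ heS hes with h | h
      · exact absurd het (B.notMem_fragments _ h)
      · exact h.2
  have h2 := congrArg Finset.card h1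
  rw [Finset.card_singleton, Finset.card_filter, sum_unitArcs_apply] at h2
  -- The `n a` reversed units count arcs back to the inner part; the `cap a - n a` others count
  -- entering arcs.
  have h3 : ∀ a, ∑ i ∈ Finset.range (N.cap a),
      (if (N.residual n hn).src ⟨a, i⟩ ∈ B.inner ∧
        (N.residual n hn).tgt ⟨a, i⟩ ∈ fragment B e then 1 else 0) =
      (if a ∈ leavingArcs B (fragment B e) then n a else 0) +
        (if a ∈ enteringArcs B (fragment B e) then N.cap a - n a else 0) := by
    intro a
    obtain ⟨k, hk⟩ := Nat.exists_eq_add_of_le (hle a)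
    rw [hk, Finset.sum_range_add]
    congr 1
    · rw [Finset.sum_congr rfl (g := fun _ => if a ∈ leavingArcs B (fragment B e) then 1 else 0)]
      · simp
      · intro i hi
        simp only [residual, Finset.mem_range.1 hi, if_true, mem_leavingArcs, and_comm]
    · rw [Finset.sum_congr rfl (g := fun _ => if a ∈ enteringArcs B (fragment B e) then 1 else 0)]
      · simp
      · intro i hi
        have : ¬ n a + i < n a := by omega
        simp only [residual, this, if_false, mem_enteringArcs]
  rw [Finset.sum_congr rfl fun a _ => h3 a, Finset.sum_add_distrib, Finset.sum_ite_mem,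
    Finset.sum_ite_mem, Finset.univ_inter, Finset.univ_inter] at h2
  have h4 : ∑ a ∈ enteringArcs B (fragment B e), (N.cap a - n a) +
      ∑ a ∈ enteringArcs B (fragment B e), n a = ∑ a ∈ enteringArcs B (fragment B e), N.cap a := by
    rw [← Finset.sum_add_distrib]
    exact Finset.sum_congr rfl fun a _ => Nat.sub_add_cancel (hle a)
  omega

theorem odd_cap_enteringArcs_fragment [Fintype V] (hf : N.IsFlow fun a => (n a : ℝ))
    (hs : N.source ∈ B.inner) {v : V} (hv : v ∈ B.fragments) :
    Odd (∑ a ∈ enteringArcs B (fragment B (B.base v)), N.cap a) := by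
  classical
  have hle : ∀ a, n a ≤ N.cap a := fun a => by exact_mod_cast hf.le_cap a
  have h1 := cap_enteringArcs_fragment B hle hv
  set Y := fragment B (B.base v) with hY
  have hsX : N.source ∉ B.fragments := B.notMem_fragments _ hs
  have h2 := N.even_sum_entering hn (Y := Y) (fun v hv => (nodeMate_mem_fragment B).2 hv)
    (fun x hx => hf.conservation x (fun h => hsX (h ▸ hx.1))
      fun h => hsX ((barrier_mate_mem_fragments B).1 (h ▸ hx.1 : N.sink ∈ B.fragments)))
  -- Flow enters `Y` from inner nodes or their mates only; the latter arcs are mates of the arcs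
  -- from `Y` to the inner part.
  have h3 : ∑ a with N.src a ∉ Y ∧ N.tgt a ∈ Y, n a =
      ∑ a ∈ enteringArcs B Y, n a + ∑ a ∈ leavingArcs B Y, n a := by
    have h4 : ∑ a ∈ leavingArcs B Y, n a =
        ∑ a, if N.arcMate a ∈ leavingArcs B Y then n a else 0 := by
      rw [← N.sum_arcMate]
      simp [N.arcMate_arcMate, hn]
    have h5 : ∑ a ∈ enteringArcs B Y, n a = ∑ a, if a ∈ enteringArcs B Y then n a else 0 := by simp
    rw [h4, h5, Finset.sum_filter, ← Finset.sum_add_distrib]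
    refine Finset.sum_congr rfl fun a _ => ?_
    simp only [mem_leavingArcs, mem_enteringArcs, N.src_arcMate, N.tgt_arcMate, hY,
      nodeMate_mem_fragment]
    rw [← hY]
    rcases Nat.eq_zero_or_pos (n a) with h0 | h0
    · simp [h0]
    by_cases ht : N.tgt a ∈ Y
    swap
    · simp [ht]
    have hnot : ∀ x ∈ B.inner, x ∉ Y ∧ N.nodeMate x ∉ B.inner := fun x hx =>
      ⟨fun h => B.notMem_fragments _ hx h.1, B.mate_notMem_inner x hx⟩
    rcases barrier_src_of_tgt_mem_fragments B (h0.trans_le (hle a)) ht.1 with h | h | h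
    · simp [ht, h, hnot _ h]
    · have h6 := (hnot _ h).1
      rw [hY, nodeMate_mem_fragment, ← hY] at h6
      have h7 := (hnot _ h).2
      rw [N.nodeMate_nodeMate] at h7
      simp [ht, h, h6, h7]
    · have h8 : N.src a ∈ Y := ⟨h.1, h.2.trans ht.2⟩
      have h9 : N.src a ∉ B.inner := fun h => (hnot _ h).1 h8
      have h10 : N.nodeMate (N.src a) ∉ B.inner :=
        fun h => (hnot _ h).1 ((nodeMate_mem_fragment B).2 h8)
      simp [ht, h8, h9, h10]
  rw [h3] at h2
  obtain ⟨k, hk⟩ := h2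
  rw [← Nat.not_even_iff_odd]
  rintro ⟨m, hm⟩
  omega

/-- The odd fragment given by a fragment of the barrier and the arcs entering it from the inner
part. -/
noncomputable def barrierFragment [Fintype V] (hf : N.IsFlow fun a => (n a : ℝ))
    (hs : N.source ∈ B.inner) (v : V) (hv : v ∈ B.fragments) : N.OddFragment where
  nodes := fragment B (B.base v)
  arcs := enteringArcs B (fragment B (B.base v))
  nodes_symm := by
    ext x
    constructor
    · rintro ⟨y, hy, rfl⟩
      exact (nodeMate_mem_fragment B).2 hy
    · exact fun hx => ⟨_, (nodeMate_mem_fragment B).2 hx, N.nodeMate_nodeMate x⟩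
  source_notMem h := B.notMem_fragments _ hs h.1
  arcs_enter a ha := by
    rw [mem_enteringArcs] at ha
    exact ⟨fun h => B.notMem_fragments _ ha.1 h.1, ha.2⟩
  odd_cap := odd_cap_enteringArcs_fragment B hf hs hv

open Classical in
/-- The signed incidence of the arcs between the inner part of the barrier and a set. -/
noncomputable def incidence (Y : Set V) (a : E) : ℝ :=
  (if a ∈ enteringArcs B Y then 1 else 0) - (if a ∈ leavingArcs B Y then 1 else 0)

/-- An arc of positive capacity crossing the fragment's boundary has its other end in the inner part
or its mate. Arcs of capacity zero have no residual units, so the barrier does not restrict them. -/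
theorem chi_barrierFragment [Fintype V] (hf : N.IsFlow fun a => (n a : ℝ))
    (hs : N.source ∈ B.inner) {v : V} (hv : v ∈ B.fragments) {a : E} (ha : 0 < N.cap a) :
    (barrierFragment B hf hs v hv).chi a = incidence B (fragment B (B.base v)) a +
      incidence B (fragment B (B.base v)) (N.arcMate a) := by
  classical
  set Y := fragment B (B.base v) with hY
  have hYm : ∀ x, N.nodeMate x ∈ Y ↔ x ∈ Y := fun x => nodeMate_mem_fragment B
  have hmate : (∃ b ∈ enteringArcs B Y, N.arcMate b = a) ↔ N.arcMate a ∈ enteringArcs B Y := by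
    constructor
    · rintro ⟨b, hb, rfl⟩
      rwa [N.arcMate_arcMate]
    · exact fun h => ⟨_, h, N.arcMate_arcMate a⟩
  have hchi : (barrierFragment B hf hs v hv).chi a =
      if a ∈ enteringArcs B Y ∨ N.arcMate a ∈ enteringArcs B Y then 1
      else if ¬(N.src a ∈ Y ↔ N.tgt a ∈ Y) then -1 else 0 := by
    simp only [OddFragment.chi, barrierFragment, ← hmate]
    congr
  have hA : ∀ x, x ∈ B.inner → N.nodeMate x ∉ B.inner := B.mate_notMem_inner
  have hAY : ∀ x, x ∈ Y → x ∉ B.inner ∧ N.nodeMate x ∉ B.inner := fun x hx =>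
    ⟨fun h => B.notMem_fragments _ h hx.1, fun h => B.notMem_fragments _ h ((hYm x).2 hx).1⟩
  have h1 := fun h : N.src a ∈ Y => barrier_tgt_of_src_mem_fragments B ha h.1
  have h2 := fun h : N.tgt a ∈ Y => barrier_src_of_tgt_mem_fragments B ha h.1
  simp only [hchi, incidence, mem_enteringArcs, mem_leavingArcs, N.src_arcMate, N.tgt_arcMate, hYm]
  have hsA := hA (N.src a)
  have htA := hA (N.tgt a)
  by_cases h3 : N.src a ∈ Y <;> by_cases h4 : N.tgt a ∈ Y
  · simp [h3, h4, hAY _ h3, hAY _ h4]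
  · have h5 : ¬(N.tgt a ∈ B.fragments ∧ B.base (N.tgt a) = B.base (N.src a)) :=
      fun h => h4 ⟨h.1, h.2.trans h3.2⟩
    rcases h1 h3 with h | h | h
    · simp [h3, h4, h, htA h]
    · have : N.tgt a ∉ B.inner := fun h' => htA h' h
      simp [h3, h4, h, this]
    · exact absurd h h5
  · have h5 : ¬(N.src a ∈ B.fragments ∧ B.base (N.src a) = B.base (N.tgt a)) :=
      fun h => h3 ⟨h.1, h.2.trans h4.2⟩
    rcases h2 h4 with h | h | h
    · simp [h3, h4, h, hsA h]
    · have : N.src a ∉ B.inner := fun h' => hsA h' h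
      simp [h3, h4, h, this]
    · exact absurd h h5
  · simp [h3, h4]

/-- The constraint is tight because there is exactly one residual unit arc from the inner part to
the fragment. -/
theorem sum_chi_barrierFragment [Fintype V] (hf : N.IsFlow fun a => (n a : ℝ))
    (hs : N.source ∈ B.inner) {v : V} (hv : v ∈ B.fragments) :
    ∑ a, (n a : ℝ) * (barrierFragment B hf hs v hv).chi a =
      2 * (∑ a ∈ (barrierFragment B hf hs v hv).arcs, (N.cap a : ℝ)) - 2 := by
  classical
  have hle : ∀ a, n a ≤ N.cap a := fun a => by exact_mod_cast hf.le_cap a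
  have h1 := congrArg (Nat.cast (R := ℝ)) (cap_enteringArcs_fragment B hle hv)
  set Y := fragment B (B.base v) with hY
  have h2 : ∀ a, (n a : ℝ) * (barrierFragment B hf hs v hv).chi a =
      n a * incidence B Y a + n a * incidence B Y (N.arcMate a) := by
    intro a
    rcases Nat.eq_zero_or_pos (n a) with h0 | h0
    · simp [h0]
    · rw [chi_barrierFragment B hf hs hv (h0.trans_le (hle a)), mul_add]
  have h3 : ∑ a, (n a : ℝ) * incidence B Y (N.arcMate a) = ∑ a, (n a : ℝ) * incidence B Y a := by
    rw [← N.sum_arcMate fun a => (n a : ℝ) * incidence B Y a]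
    exact Finset.sum_congr rfl fun a _ => by rw [hn]
  have h4 : ∑ a, (n a : ℝ) * incidence B Y a =
      ∑ a ∈ enteringArcs B Y, (n a : ℝ) - ∑ a ∈ leavingArcs B Y, (n a : ℝ) := by
    simp [incidence, mul_sub, Finset.sum_sub_distrib]
  rw [Finset.sum_congr rfl fun a _ => h2 a, Finset.sum_add_distrib, h3, h4]
  change _ = 2 * (∑ a ∈ enteringArcs B Y, (N.cap a : ℝ)) - 2
  push_cast at h1
  linarith

open Classical in
/-- The base arcs of the fragments. -/
noncomputable def baseArcs : Finset (Σ _ : E, ℕ) :=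
  (unitArcs N.cap).filter fun e => ∃ v ∈ B.fragments, B.base v = e

theorem mem_baseArcs {e : Σ _ : E, ℕ} :
    e ∈ baseArcs B ↔ e ∈ unitArcs N.cap ∧ ∃ v ∈ B.fragments, B.base v = e := by
  simp [baseArcs]

theorem sum_incidence_fragment (a : E) :
    ∑ e ∈ baseArcs B, incidence B (fragment B e) a = incidence B B.fragments a := by
  classical
  have hmem : ∀ v ∈ B.fragments, B.base v ∈ baseArcs B := fun v hv =>
    (mem_baseArcs B).2 ⟨B.base_mem v hv, v, hv, rfl⟩
  have key : ∀ (v : V) (p : Prop), ∑ e ∈ baseArcs B, (if p ∧ v ∈ fragment B e then 1 else 0 : ℝ) =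
      if p ∧ v ∈ B.fragments then 1 else 0 := by
    intro v p
    by_cases hp : p
    swap
    · simp [hp]
    by_cases hv : v ∈ B.fragments
    · simp [hp, hv, fragment, hmem v hv]
    · simp [hv, fragment]
  simp only [incidence, mem_enteringArcs, mem_leavingArcs, Finset.sum_sub_distrib]
  rw [key]
  simp only [and_comm (b := N.tgt a ∈ B.inner)]
  rw [key]

open Classical in
/-- Complementary slackness outside of the fragments. -/
theorem mul_cut_sub_incidence_nonpos (hle : ∀ a, n a ≤ N.cap a) {a : E} {t : ℝ} (h0 : 0 ≤ t)
    (ht : t ≤ N.cap a) :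
    (t - n a) * (((if N.src a ∈ B.inner then 1 else 0) - (if N.tgt a ∈ B.inner then 1 else 0)) -
      incidence B B.fragments a) ≤ 0 := by
  simp only [incidence, mem_enteringArcs, mem_leavingArcs]
  have hA : ∀ x, x ∈ B.inner → x ∉ B.fragments := B.notMem_fragments
  by_cases h1 : N.src a ∈ B.inner <;> by_cases h2 : N.tgt a ∈ B.inner
  · simp [h1, h2, hA _ h1, hA _ h2]
  · by_cases h3 : N.tgt a ∈ B.fragments
    · simp [h1, h2, h3, hA _ h1]
    · have : n a = N.cap a := by
        refine le_antisymm (hle a) (not_lt.1 fun h => ?_)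
        exact (barrier_tgt_of_unsaturated B h h1).elim h2 h3
      simp [h1, h2, h3, this, ht]
  · by_cases h3 : N.src a ∈ B.fragments
    · simp [h1, h2, h3]
    · have : n a = 0 := by
        by_contra h
        exact (barrier_src_of_pos B (hle a) (Nat.pos_of_ne_zero h) h2).elim h1 h3
      simp [h1, h2, h3, this, h0]
  · simp [h1, h2]

/-- Twice the gain of `g` over `n` splits into slackness terms `r` of arcs and of their mates, and
one term per fragment; each is nonpositive. -/
theorem value_le_of_barrier [Fintype V] (hf : N.IsFlow fun a => (n a : ℝ))
    (hs : N.source ∈ B.inner) {g : E → ℝ} (hg : g ∈ N.lpFeasible) :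
    N.value g ≤ N.value fun a => (n a : ℝ) := by
  classical
  obtain ⟨hg, hodd⟩ := hg
  have hle : ∀ a, n a ≤ N.cap a := fun a => by exact_mod_cast hf.le_cap a
  have hs' : N.sink ∉ B.inner := B.mate_notMem_inner _ hs
  set c : E → ℝ := fun a =>
    (if N.src a ∈ B.inner then 1 else 0) - (if N.tgt a ∈ B.inner then 1 else 0) with hc
  set r : E → ℝ := fun a => c a - incidence B B.fragments a with hr
  have hdouble : ∀ {f : E → ℝ}, N.IsFlow f → ∑ a, f a * (c a + c (N.arcMate a)) = 2 * N.value f := by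
    intro f hf
    have h1 := hf.sum_mul_cut_eq_value hs hs'
    have h2 := hf.comp_arcMate.sum_mul_cut_eq_value hs hs'
    rw [hf.value_comp_arcMate, ← N.sum_arcMate] at h2
    simp only [N.arcMate_arcMate] at h2
    simp only [mul_add, Finset.sum_add_distrib]
    linarith
  have hr0 : ∀ a, (g a - n a) * r a ≤ 0 := fun a =>
    mul_cut_sub_incidence_nonpos B hle (hg.nonneg a) (hg.le_cap a)
  have hr1 : ∀ a, (g a - n a) * r (N.arcMate a) ≤ 0 := fun a => by
    have := mul_cut_sub_incidence_nonpos B hle (a := N.arcMate a) (hg.nonneg a)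
      (by rw [N.cap_arcMate]; exact hg.le_cap a)
    rwa [hn] at this
  have hcr : ∀ a, c a = r a + ∑ e ∈ baseArcs B, incidence B (fragment B e) a := fun a => by
    rw [sum_incidence_fragment, hr]
    ring
  have hfrag : ∀ e ∈ baseArcs B, ∑ a, (g a - n a) * (incidence B (fragment B e) a +
      incidence B (fragment B e) (N.arcMate a)) ≤ 0 := by
    intro e he
    obtain ⟨-, v, hv, rfl⟩ := (mem_baseArcs B).1 he
    have h1 := hodd (barrierFragment B hf hs v hv)
    have h2 := sum_chi_barrierFragment B hf hs hv
    have h3 : ∀ a, (g a - n a) * (incidence B (fragment B (B.base v)) a +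
        incidence B (fragment B (B.base v)) (N.arcMate a)) =
        g a * (barrierFragment B hf hs v hv).chi a -
          n a * (barrierFragment B hf hs v hv).chi a := by
      intro a
      -- On arcs of capacity zero both flows vanish, so the value of χ there is immaterial.
      rcases Nat.eq_zero_or_pos (N.cap a) with h0 | h0
      · have h4 : n a = 0 := Nat.le_zero.1 (h0 ▸ hle a)
        have h5 : g a = 0 := le_antisymm (by simpa [h0] using hg.le_cap a) (hg.nonneg a)
        simp [h4, h5]
      · rw [chi_barrierFragment B hf hs hv h0]
        ring
    rw [Finset.sum_congr rfl fun a _ => h3 a, Finset.sum_sub_distrib]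
    linarith
  have hsplit : ∑ a, (g a - n a) * (c a + c (N.arcMate a)) =
      ∑ a, (g a - n a) * r a + ∑ a, (g a - n a) * r (N.arcMate a) +
      ∑ e ∈ baseArcs B, ∑ a, (g a - n a) * (incidence B (fragment B e) a +
        incidence B (fragment B e) (N.arcMate a)) := by
    rw [Finset.sum_comm, ← Finset.sum_add_distrib, ← Finset.sum_add_distrib]
    refine Finset.sum_congr rfl fun a _ => ?_
    rw [← Finset.mul_sum, Finset.sum_add_distrib, hcr a, hcr (N.arcMate a)]
    ring
  have h1 := hdouble hg
  have h2 := hdouble hf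
  have h3 : ∑ a, (g a - n a) * (c a + c (N.arcMate a)) =
      2 * N.value g - 2 * N.value fun a => (n a : ℝ) := by
    rw [← h1, ← h2, ← Finset.sum_sub_distrib]
    exact Finset.sum_congr rfl fun a _ => by ring
  have h4 := Finset.sum_nonpos fun a (_ : a ∈ Finset.univ) => hr0 a
  have h5 := Finset.sum_nonpos fun a (_ : a ∈ Finset.univ) => hr1 a
  have h6 := Finset.sum_nonpos hfrag
  linarith

end Barrier

theorem IsMaximumISFlow.value_le [Fintype V] {N : SkewSymmetricNetwork V E} {f : E → ℝ}
    (hf : N.IsMaximumISFlow f) {g : E → ℝ} (hg : g ∈ N.lpFeasible) : N.value g ≤ N.value f := by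
  rcases isEmpty_or_nonempty E with hE | hE
  · rw [Subsingleton.elim g f]
  · obtain ⟨n, rfl⟩ := hf.1.exists_nat
    have hn : ∀ a, n (N.arcMate a) = n a := fun a => by exact_mod_cast (hf.1.symmetric a).symm
    obtain ⟨B, hs⟩ := IsMaximumISFlow.exists_barrier hn hf
    exact value_le_of_barrier B hf.1.toIsFlow hs hg

end SkewSymmetricNetwork

theorem theorem4p1 {V E : Type*} [Fintype V] [Fintype E] (N : SkewSymmetricNetwork V E)
    (no_arc_enters_source : ∀ a : E, N.tgt a ≠ N.source) :
    (∀ f : E → ℝ, N.IsMaximumISFlow f →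
      f ∈ N.lpFeasible ∧ ∀ g ∈ N.lpFeasible, N.outflow g ≤ N.outflow f) ∧
    ∃ c : ℝ,
      IsGreatest (N.outflow '' {f | N.IsISFlow f}) c ∧
      IsGreatest (N.outflow '' {f | N.IsISFlow f ∧ N.SatisfiesOddFragmentConstraints f}) c ∧
      IsGreatest (N.outflow '' N.lpFeasible) c := by
  have hout : N.outflow = N.value := funext (N.outflow_eq_value no_arc_enters_source)
  have hopt : ∀ f, N.IsMaximumISFlow f →
      f ∈ N.lpFeasible ∧ ∀ g ∈ N.lpFeasible, N.outflow g ≤ N.outflow f := fun f hf =>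
    ⟨⟨hf.1.toIsFlow, hf.1.satisfiesOddFragmentConstraints⟩, fun g hg => by
      rw [hout]
      exact hf.value_le hg⟩
  obtain ⟨f, hf⟩ := N.exists_isMaximumISFlow
  obtain ⟨hfeas, hmax⟩ := hopt f hf
  refine ⟨hopt, N.outflow f, ⟨⟨f, hf.1, rfl⟩, ?_⟩, ⟨⟨f, ⟨hf.1, hfeas.2⟩, rfl⟩, ?_⟩,
    ⟨⟨f, hfeas, rfl⟩, ?_⟩⟩
  · rintro _ ⟨g, hg, rfl⟩
    exact hmax g ⟨hg.toIsFlow, hg.satisfiesOddFragmentConstraints⟩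
  · rintro _ ⟨g, ⟨hg, hg'⟩, rfl⟩
    exact hmax g ⟨hg.toIsFlow, hg'⟩
  · rintro _ ⟨g, hg, rfl⟩
    exact hmax g hg
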